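/- Fix an integer lead time $L\ge 0$, a unit holding cost $h>0$, a unit penalty $p>0$ and $\lambda_0\in(0,1)$. Time is divided into cycles of $T\ge1$ periods; in each period, independently, one customer arrives with probability $1-\lambda_0$ and none with probability $\lambda_0$. Let $D^n\sim\mathrm{Bin}(T,1-\lambda_0)$ be the demand in cycle $n$, and put $P_k=\Pr\bigl(\sum_{n=1}^{L+1}D^n=k\bigr)$ and $P_{n,k}=\Pr\bigl(\sum_{i=1}^{n}D^i=k\bigr)$. *Base-stock policy, backorder system.* At the beginning of each cycle an order is placed that raises the inventory position (net inventory plus outstanding orders) to $S$; it arrives $L$ cycles later. Unmet demand is backordered. Let $C_{\mathbf b}^{\mathscr B,S}(h,b)$ be the long-run average expected cost per cycle, with holding cost $h$ per unit on hand and penalty $b$ per unit backordered at the end of each cycle, and let $\bar S$ and $\underline S$ be minimizers over $S$ of $C_{\mathbf b}^{\mathscr B,S}(h,p+Lh)$ and of $C_{\mathbf b}^{\mathscr B,S}(h,\tfrac{p}{L+1})$. *Constant-order policy, lost-sales system.* A quantity $c$ arrives at the beginning of each cycle, as much demand as possible is fulfilled in each cycle, and unmet demand is lost. Let $C_{\mathbf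 c}^{c}(h,p)\in[0,\infty]$ be the long-run average expected cost per cycle, with holding cost $h$ per unit left at the end of each cycle and penalty $p$ per lost sale, and let $c^*$ be a minimizer of it over $c$. Here $S$ and $c$ range either both over the nonnegative integers or both over the nonnegative reals; the result holds in both cases. Define $$\bar a_1(T,h,p,L)=h\sum_{k=0}^{\lfloor\bar S\rfloor}(\bar S-k)P_k+(p+Lh)\sum_{k=\lfloor\bar S\rfloor+1}^{(L+1)T}(k-\bar S)P_k,$$ $$\underline a_1(T,h,p,L)=h\sum_{k=0}^{\lfloor\underline S\rfloor}(\underline S-k)P_k+\frac{p}{L+1}\sum_{k=\lfloor\underline S\rfloor+1}^{(L+1)T}(k-\underline S)P_k,$$ $$a_2(T,h,p)=h\sum_{n=1}^{\infty}\sum_{k=0}^{\lfloor nc^*\rfloor}\Bigl(c^*-\frac kn\Bigr)P_{n,k}+pT(1-\lambda_0)-pc^*.$$ Then for every $T\ge1$ the minimizers $\bar S,\underline S,c^*$ exist and the series in $a_2$ converges, and for every choice of minimizers, as $T\to\infty$ with $L,h,p,\lambda_0$ fixed, $$\bar a_1(T,h,p,L)=\Theta(\sqrt T),\qquad \underline a_1(T,h,p,L)=\Theta(\sqrt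 T),\qquad a_2(T,h,p)=\Theta(\sqrt T).$$ -/

import Mathlib

open MeasureTheory ProbabilityTheory Filter Asymptotics
open scoped ENNReal BigOperators

noncomputable section

namespace Replenishment

/-- An arrival path: `H (n, t)` says whether a customer arrives in period `t` of cycle `n`
(cycles and periods are numbered from `0`). -/
abbrev Path : Type := ℕ × ℕ → Bool

/-- The law of the arrival path: independent arrivals, each with probability `1 - lam0`. -/
def pathLaw (lam0 : unitInterval) : Measure Path :=
  Measure.infinitePi fun _ : ℕ × ℕ => bernoulliMeasure true false (unitInterval.symm lam0)

/-- Total demand in cycle `n`, a cycle consisting of the periods `0, …, T - 1`. -/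
def demand (T : ℕ) (H : Path) (n : ℕ) : ℕ :=
  ((Finset.range T).filter fun t => H (n, t) = true).card

/-- Long-run average expected cost per cycle, `limsup_N (1/N) ∑_{n < N} E[cost n]`.
It is `∞` for systems whose average cost grows without bound. -/
def longRunAverage (lam0 : unitInterval) (cost : ℕ → Path → ℝ≥0∞) : ℝ≥0∞ :=
  limsup (fun N : ℕ => (∑ n ∈ Finset.range N, ∫⁻ H, cost n H ∂(pathLaw lam0)) / (N : ℝ≥0∞)) atTop

/-! ### Base-stock policy in the backorder system -/

/-- State at the end of a cycle: `net` is the net inventory (negative if customers are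
backordered), and `orders l` is the outstanding order that arrives at the beginning of the
`l`-th cycle from now (`l = 0` being the cycle that is about to begin). -/
structure BackorderState where
  net : ℝ
  orders : ℕ → ℝ

/-- One cycle with lead time `L`, base-stock level `S` and demand `d`. The order placed at the
beginning of the cycle arrives `L` cycles later and raises the inventory position (net inventory
plus outstanding orders, over the orders `0, …, L - 1`) to `S`; then the order due in this cycle is
received, the demand is met or backordered, and the pipeline shifts. -/
def backorderStep (L : ℕ) (S : ℝ) (d : ℕ) (s : BackorderState) : BackorderState :=
  let q : ℕ → ℝ :=
    Function.update s.orders L (S - s.net - ∑ l ∈ Finset.range L, s.orders l)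
  ⟨s.net + q 0 - d, fun l => q (l + 1)⟩

/-- The state before cycle `n`. The system starts with `S` units and an empty pipeline. -/
def backorderState (L T : ℕ) (S : ℝ) (H : Path) : ℕ → BackorderState
  | 0 => ⟨S, fun _ => 0⟩
  | n + 1 => backorderStep L S (demand T H n) (backorderState L T S H n)

/-- Long-run average cost of the base-stock policy with level `S` in the backorder system, with
unit holding cost `h` and unit backorder penalty `b` charged on the net inventory at the end of
every cycle. -/
def backorderCost (lam0 : unitInterval) (L T : ℕ) (h b S : ℝ) : ℝ≥0∞ :=
  longRunAverage lam0 fun n H =>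
    let x : ℝ := (backorderState L T S H (n + 1)).net
    ENNReal.ofReal (h * max x 0 + b * max (-x) 0)

/-! ### Constant-order policy in the lost-sales system -/

/-- On-hand inventory at the beginning of cycle `n`, after the arrival of the order `c`: in every
cycle as much demand as possible is fulfilled, and unmet demand is lost. -/
def constantStart (T : ℕ) (c : ℝ) (H : Path) : ℕ → ℝ
  | 0 => c
  | n + 1 => (constantStart T c H n - min (constantStart T c H n) (demand T H n)) + c

/-- Long-run average cost of the constant-order policy with order quantity `c` in the lost-sales
system, with unit holding cost `h` on the inventory left at the end of every cycle and penalty `p`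
per lost sale. -/
def constantCost (lam0 : unitInterval) (T : ℕ) (h p c : ℝ) : ℝ≥0∞ :=
  longRunAverage lam0 fun n H =>
    let I : ℝ := constantStart T c H n
    let f : ℝ := min I (demand T H n)
    ENNReal.ofReal (h * (I - f) + p * (demand T H n - f))

/-! ### The three functions -/

/-- `x` minimizes `f` over the set `A` of admissible values. -/
def IsOptimal (A : Set ℝ) (f : ℝ → ℝ≥0∞) (x : ℝ) : Prop :=
  x ∈ A ∧ IsMinOn f A x

/-- The probability that a binomial variable with `m` trials and success probability `1 - lam0`
equals `k`. -/
def binomialProb (lam0 : unitInterval) (m k : ℕ) : ℝ :=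
  (m.choose k : ℝ) * (1 - (lam0 : ℝ)) ^ k * (lam0 : ℝ) ^ (m - k)

/-- Expected overage and underage cost of the base-stock level `S` against the demand over `L + 1`
cycles of length `T`, with unit overage cost `h` and unit underage cost `b`. -/
def pipelineCost (lam0 : unitInterval) (L T : ℕ) (h b S : ℝ) : ℝ :=
  h * ∑ k ∈ Finset.range (⌊S⌋₊ + 1), (S - k) * binomialProb lam0 ((L + 1) * T) k +
    b * ∑ k ∈ Finset.Icc (⌊S⌋₊ + 1) ((L + 1) * T), (k - S) * binomialProb lam0 ((L + 1) * T) k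

/-- The upper envelope `ā₁`, at a backorder-optimal level `S` for the penalty `p + L h`. -/
def a1Upper (lam0 : unitInterval) (L T : ℕ) (h p S : ℝ) : ℝ :=
  pipelineCost lam0 L T h (p + L * h) S

/-- The lower envelope `a̲₁`, at a backorder-optimal level `S` for the penalty `p / (L + 1)`. -/
def a1Lower (lam0 : unitInterval) (L T : ℕ) (h p S : ℝ) : ℝ :=
  pipelineCost lam0 L T h (p / (L + 1)) S

/-- The `n`-th term (`n ≥ 1`) of the series in `a₂`, for the order quantity `c`. -/
def a2Term (lam0 : unitInterval) (T : ℕ) (c : ℝ) (n : ℕ) : ℝ :=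
  ∑ k ∈ Finset.range (⌊n * c⌋₊ + 1), (c - k / n) * binomialProb lam0 (n * T) k

/-- The function `a₂`, at an optimal constant order quantity `c`. -/
def a2 (lam0 : unitInterval) (T : ℕ) (h p c : ℝ) : ℝ :=
  h * ∑' n : ℕ, a2Term lam0 T c (n + 1) + p * T * (1 - (lam0 : ℝ)) - p * c

end Replenishment

end

namespace Replenishment

open scoped Topology

/-! ### Resampling coordinates of the arrival path -/

/-! Write q = 1 - λ₀. Under a base-stock policy the net inventory at the end of a cycle is S minus
the demand of the last L+1 cycles (`backorder_net`), so the cost is the newsvendor cost of S against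
Bin((L+1)T, q) (`backorderCost_eq`), which is `pipelineCost`. At S = ⌈(L+1)Tq⌉ it is O(√T) because
the mean absolute deviation is at most the standard deviation. For every S it is at least a constant
times √T, by a fourth-moment argument (`sqrt_le_binExp_abs`).

For constant orders put δ = Tq - c. The leftover follows Lindley's recursion from 0, so its mean e_n
increases with n and the cost is sup_n (h e_n + pδ) (`constantCost_eq_iSup`). Kingman's bound gives
e_n ≤ (T q(1-q) + δ²)/(2δ) for δ > 0, so some c with δ of order √T costs O(√T). The random walk with
steps c - D gives e_n ≥ κ√(nT) - n max(δ, 0). Hence δ ≤ 0 costs ∞. For an optimal c, a fixed large n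
forces δ ≥ η√T, since the cost is at most G√T.

Finally a₂ = h Σ + pδ with Σ ≥ 0. A fourth-moment tail bound gives Σ ≤ const · T²/δ³ = O(√T), and pδ
lies between constant multiples of √T. That a₂ equals the optimal cost is never needed. -/

instance (lam0 : unitInterval) : IsProbabilityMeasure (pathLaw lam0) := by
  unfold pathLaw; infer_instance

/-- Both laws agree on finite cylinders: the factor at `a` comes from the fresh bit, the remaining
factors from the old path. -/
lemma measurePreserving_update (lam0 : unitInterval) (a : ℕ × ℕ) :
    MeasurePreserving (fun z : Path × Bool => Function.update z.1 a z.2)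
      ((pathLaw lam0).prod (bernoulliMeasure true false (unitInterval.symm lam0)))
      (pathLaw lam0) := by
  have hm : Measurable (fun z : Path × Bool => Function.update z.1 a z.2) := by
    refine measurable_pi_lambda _ fun i => ?_
    by_cases hi : i = a
    · subst hi; simpa using measurable_snd
    · simp only [Function.update_of_ne hi]; fun_prop
  refine ⟨hm, ?_⟩
  refine Measure.eq_infinitePi _ fun s t ht => ?_
  rw [Measure.map_apply hm (MeasurableSet.pi s.countable_toSet fun i _ => ht i)]
  by_cases has : a ∈ s
  · have : (fun z : Path × Bool => Function.update z.1 a z.2) ⁻¹' Set.pi s t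
        = (Set.pi (s.erase a) t) ×ˢ t a := by
      ext ⟨H, b⟩
      simp only [Set.mem_preimage, Set.mem_pi, Finset.mem_coe, Set.mem_prod, Finset.mem_erase]
      constructor
      · intro hH
        refine ⟨fun i hi => ?_, by simpa using hH a has⟩
        simpa [Function.update_of_ne hi.1] using hH i hi.2
      · rintro ⟨h1, h2⟩ i hi
        by_cases hia : i = a
        · subst hia; simpa using h2
        · simpa [Function.update_of_ne hia] using h1 i ⟨hia, hi⟩
    rw [this, Measure.prod_prod, pathLaw, Measure.infinitePi_pi _ (fun i _ => ht i),
      Finset.prod_erase_mul s (fun i => (bernoulliMeasure true false (unitInterval.symm lam0)) (t i)) has]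
  · have : (fun z : Path × Bool => Function.update z.1 a z.2) ⁻¹' Set.pi s t
        = (Set.pi s t) ×ˢ Set.univ := by
      ext ⟨H, b⟩
      simp only [Set.mem_preimage, Set.mem_pi, Finset.mem_coe, Set.mem_prod, Set.mem_univ, and_true]
      refine forall₂_congr fun i hi => ?_
      rw [Function.update_of_ne (by rintro rfl; exact has hi)]
    rw [this, Measure.prod_prod, pathLaw, Measure.infinitePi_pi _ (fun i _ => ht i)]
    simp

/-- Path space is compact, and every quantity below depends continuously on the path, so
integrability is automatic. -/
lemma integrable_of_continuous (lam0 : unitInterval) {Φ : Path → ℝ} (hΦ : Continuous Φ) :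
    Integrable Φ (pathLaw lam0) :=
  hΦ.integrable_of_hasCompactSupport (HasCompactSupport.of_compactSpace Φ)

lemma continuous_update_const (a : ℕ × ℕ) (b : Bool) :
    Continuous fun H : Path => Function.update H a b := by fun_prop

/-- Resampling one coordinate does not change the law of the path. -/
lemma integral_resample (lam0 : unitInterval) (a : ℕ × ℕ) {Φ : Path → ℝ} (hΦ : Continuous Φ) :
    ∫ H, Φ H ∂(pathLaw lam0) =
      (1 - (lam0 : ℝ)) * ∫ H, Φ (Function.update H a true) ∂(pathLaw lam0) +
        (lam0 : ℝ) * ∫ H, Φ (Function.update H a false) ∂(pathLaw lam0) := by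
  have hmp := measurePreserving_update lam0 a
  have hi : Integrable Φ (pathLaw lam0) := integrable_of_continuous lam0 hΦ
  have hi' : Integrable (fun z : Path × Bool => Φ (Function.update z.1 a z.2))
      ((pathLaw lam0).prod (bernoulliMeasure true false (unitInterval.symm lam0))) :=
    hmp.integrable_comp_of_integrable hi
  have h1 : ∫ H, Φ H ∂(pathLaw lam0) = ∫ z, Φ (Function.update z.1 a z.2)
      ∂((pathLaw lam0).prod (bernoulliMeasure true false (unitInterval.symm lam0))) := by
    have hsm := hi.aestronglyMeasurable
    rw [← hmp.map_eq] at hsm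
    rw [← integral_map hmp.measurable.aemeasurable hsm, hmp.map_eq]
  rw [h1, integral_prod _ hi']
  simp only [integral_bernoulliMeasure]
  rw [integral_add]
  · simp only [smul_eq_mul, integral_const_mul]
    simp
  · exact integrable_of_continuous lam0
      (continuous_const.mul (hΦ.comp (continuous_update_const a true)))
  · exact integrable_of_continuous lam0
      (continuous_const.mul (hΦ.comp (continuous_update_const a false)))

/-! ### Binomial expectations -/

/-- The expectation of `g` under the binomial law with `m` trials and success probability `q`. -/
noncomputable def binExp (q : ℝ) : ℕ → (ℕ → ℝ) → ℝ
  | 0, g => g 0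
  | m + 1, g => q * binExp q m (fun k => g (k + 1)) + (1 - q) * binExp q m g

/-- The number of arrivals in the set `s` of periods. -/
def arrivals (s : Finset (ℕ × ℕ)) (H : Path) : ℕ := (s.filter fun i => H i = true).card

lemma arrivals_insert {s : Finset (ℕ × ℕ)} {a : ℕ × ℕ} (ha : a ∉ s) (H : Path) :
    arrivals (insert a s) H = arrivals s H + if H a = true then 1 else 0 := by
  unfold arrivals
  rw [Finset.filter_insert]
  split_ifs with h
  · rw [Finset.card_insert_of_notMem (by simp [ha])]
  · simp

lemma arrivals_update {s : Finset (ℕ × ℕ)} {a : ℕ × ℕ} (ha : a ∉ s) (H : Path) (b : Bool) :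
    arrivals s (Function.update H a b) = arrivals s H := by
  unfold arrivals
  congr 1
  refine Finset.filter_congr fun i hi => ?_
  rw [Function.update_of_ne (by rintro rfl; exact ha hi)]

lemma continuous_arrivals (s : Finset (ℕ × ℕ)) : Continuous (arrivals s) := by
  have : arrivals s = fun H : Path => ∑ i ∈ s, (fun b : Bool => if b = true then 1 else 0) (H i) := by
    ext H; exact Finset.card_filter _ _
  rw [this]
  exact continuous_finsetSum _ fun i _ =>
    (continuous_of_discreteTopology (f := fun b : Bool => if b = true then 1 else 0)).comp
      (continuous_apply i)

lemma continuous_apply_nat {F : Path → ℕ → ℝ} (hF : ∀ k, Continuous fun H => F H k)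
    {N : Path → ℕ} (hN : Continuous N) : Continuous fun H => F H (N H) := by
  have : Continuous fun z : Path × ℕ => F z.1 z.2 :=
    continuous_prod_of_discrete_right.mpr hF
  exact this.comp (continuous_id.prodMk hN)

lemma binExp_congr {q : ℝ} {m : ℕ} {g g' : ℕ → ℝ} (h : ∀ k, g k = g' k) :
    binExp q m g = binExp q m g' := by rw [funext h]

lemma continuous_binExp {X : Type*} [TopologicalSpace X] (q : ℝ) (m : ℕ) {F : X → ℕ → ℝ}
    (hF : ∀ k, Continuous fun x => F x k) : Continuous fun x => binExp q m (F x) := by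
  induction m generalizing F with
  | zero => exact hF 0
  | succ m ih =>
    exact (continuous_const.mul (ih fun k => hF (k + 1))).add (continuous_const.mul (ih hF))

/-- Conditionally on the periods outside `s`, the number of arrivals in `s` is binomial. -/
lemma integral_arrivals (lam0 : unitInterval) (s : Finset (ℕ × ℕ)) {F : Path → ℕ → ℝ}
    (hF : ∀ k, Continuous fun H => F H k)
    (hs : ∀ a ∈ s, ∀ b H k, F (Function.update H a b) k = F H k) :
    ∫ H, F H (arrivals s H) ∂(pathLaw lam0) =
      ∫ H, binExp (1 - (lam0 : ℝ)) s.card (F H) ∂(pathLaw lam0) := by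
  induction s using Finset.induction_on generalizing F with
  | empty => simp [arrivals, binExp]
  | insert a s ha ih =>
    have hc := continuous_apply_nat hF (continuous_arrivals (insert a s))
    -- Averaging over the bit at `a` reproduces the recursion of `binExp`: an arrival shifts the
    -- argument by one.
    rw [integral_resample lam0 a hc]
    simp only [arrivals_insert ha, arrivals_update ha, hs a (Finset.mem_insert_self a s),
      Function.update_self, if_true, Bool.false_eq_true, if_false, add_zero]
    have hs' : ∀ i ∈ s, ∀ b H k, F (Function.update H i b) k = F H k :=
      fun i hi => hs i (Finset.mem_insert_of_mem hi)
    rw [ih hF hs', ih (F := fun H k => F H (k + 1)) (fun k => hF (k + 1))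
      (fun i hi b H k => hs' i hi b H (k + 1)), Finset.card_insert_of_notMem ha]
    simp only [binExp]
    rw [integral_add, integral_const_mul, integral_const_mul]
    · ring_nf
    · exact (integrable_of_continuous lam0
        (continuous_binExp _ _ fun k => hF (k + 1))).const_mul _
    · exact (integrable_of_continuous lam0 (continuous_binExp _ _ hF)).const_mul _

lemma integral_comp_arrivals (lam0 : unitInterval) (s : Finset (ℕ × ℕ)) (g : ℕ → ℝ) :
    ∫ H, g (arrivals s H) ∂(pathLaw lam0) = binExp (1 - (lam0 : ℝ)) s.card g := by
  rw [integral_arrivals lam0 s (F := fun _ => g) (fun _ => continuous_const)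
    (fun _ _ _ _ _ => rfl)]
  simp

lemma binomialProb_eq_zero (lam0 : unitInterval) {m k : ℕ} (h : m < k) :
    binomialProb lam0 m k = 0 := by simp [binomialProb, Nat.choose_eq_zero_of_lt h]

lemma binomialProb_succ_zero (lam0 : unitInterval) (m : ℕ) :
    binomialProb lam0 (m + 1) 0 = lam0 * binomialProb lam0 m 0 := by
  simp [binomialProb, pow_succ']

lemma binomialProb_succ_succ (lam0 : unitInterval) (m k : ℕ) :
    binomialProb lam0 (m + 1) (k + 1) =
      (1 - lam0) * binomialProb lam0 m k + lam0 * binomialProb lam0 m (k + 1) := by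
  rcases lt_or_ge m (k + 1) with h | h
  · rw [binomialProb_eq_zero lam0 h]
    rcases eq_or_lt_of_le (Nat.lt_succ_iff.mp h) with h | h
    · subst h; simp [binomialProb, pow_succ']
    · rw [binomialProb_eq_zero lam0 h, binomialProb_eq_zero lam0 (by omega)]; simp
  · obtain ⟨j, rfl⟩ := Nat.exists_eq_add_of_le h
    have e1 : k + 1 + j + 1 - (k + 1) = j + 1 := by omega
    have e2 : k + 1 + j - k = j + 1 := by omega
    have e3 : k + 1 + j - (k + 1) = j := by omega
    simp only [binomialProb, Nat.choose_succ_succ', e1, e2, e3]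
    push_cast
    ring

/-- Any cutoff beyond `m` is allowed because the probabilities vanish there; the induction step uses
two different cutoffs. -/
lemma binExp_eq_sum (lam0 : unitInterval) (m : ℕ) (g : ℕ → ℝ) {R : ℕ} (hR : m < R) :
    binExp (1 - (lam0 : ℝ)) m g = ∑ k ∈ Finset.range R, g k * binomialProb lam0 m k := by
  induction m generalizing g R with
  | zero =>
    rw [Finset.sum_eq_single_of_mem 0 (by simpa using hR)
      (fun k _ hk => by rw [binomialProb_eq_zero lam0 (by omega), mul_zero])]
    simp [binExp, binomialProb]
  | succ m ih =>
    obtain ⟨R, rfl⟩ : ∃ R', R = R' + 1 := ⟨R - 1, by omega⟩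
    rw [binExp, ih (fun k => g (k + 1)) (R := R) (by omega), ih g (R := R + 1) (by omega),
      Finset.sum_range_succ', Finset.sum_range_succ' (fun k => g k * binomialProb lam0 (m + 1) k),
      binomialProb_succ_zero, mul_add, Finset.mul_sum, Finset.mul_sum, ← add_assoc,
      ← Finset.sum_add_distrib]
    congr 1
    · refine Finset.sum_congr rfl fun k _ => ?_
      rw [binomialProb_succ_succ]; ring
    · ring

lemma binExp_add (q : ℝ) (m : ℕ) (f g : ℕ → ℝ) :
    binExp q m (fun k => f k + g k) = binExp q m f + binExp q m g := by
  induction m generalizing f g with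
  | zero => rfl
  | succ m ih =>
    simp only [binExp, ih f g, ih (fun k => f (k + 1)) (fun k => g (k + 1))]; ring

lemma binExp_const_mul (q : ℝ) (m : ℕ) (a : ℝ) (f : ℕ → ℝ) :
    binExp q m (fun k => a * f k) = a * binExp q m f := by
  induction m generalizing f with
  | zero => rfl
  | succ m ih => simp only [binExp, ih f, ih (fun k => f (k + 1))]; ring

lemma binExp_const (q : ℝ) (m : ℕ) (a : ℝ) : binExp q m (fun _ => a) = a := by
  induction m with
  | zero => rfl
  | succ m ih => simp only [binExp, ih]; ring

lemma binExp_mono {q : ℝ} (h0 : 0 ≤ q) (h1 : q ≤ 1) (m : ℕ) {f g : ℕ → ℝ}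
    (h : ∀ k, f k ≤ g k) : binExp q m f ≤ binExp q m g := by
  induction m generalizing f g with
  | zero => exact h 0
  | succ m ih =>
    exact add_le_add (mul_le_mul_of_nonneg_left (ih fun k => h (k + 1)) h0)
      (mul_le_mul_of_nonneg_left (ih h) (by linarith))

lemma binExp_mono_of_le {q : ℝ} (h0 : 0 ≤ q) (h1 : q ≤ 1) (m : ℕ) {f g : ℕ → ℝ}
    (h : ∀ k ≤ m, f k ≤ g k) : binExp q m f ≤ binExp q m g := by
  induction m generalizing f g with
  | zero => exact h 0 le_rfl
  | succ m ih =>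
    exact add_le_add
      (mul_le_mul_of_nonneg_left (ih fun k hk => h (k + 1) (by omega)) h0)
      (mul_le_mul_of_nonneg_left (ih fun k hk => h k (by omega)) (by linarith))

/-! ### Central moments of the binomial law -/

lemma binExp_centered (q : ℝ) (m : ℕ) (φ : ℝ → ℝ) :
    binExp q (m + 1) (fun k => φ (k - ((m + 1 : ℕ) : ℝ) * q)) =
      binExp q m (fun k => q * φ ((k - m * q) + (1 - q)) + (1 - q) * φ ((k - m * q) - q)) := by
  rw [binExp, binExp_add, binExp_const_mul, binExp_const_mul]
  congr 2 <;> refine binExp_congr fun k => ?_ <;> congr 1 <;> push_cast <;> ring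

lemma binExp_centered_one (q : ℝ) (m : ℕ) : binExp q m (fun k => (k : ℝ) - m * q) = 0 := by
  induction m with
  | zero => simp [binExp]
  | succ m ih =>
    rw [binExp_centered q m (fun x => x), ← ih]
    exact binExp_congr fun k => by ring

lemma binExp_centered_sq (q : ℝ) (m : ℕ) :
    binExp q m (fun k => ((k : ℝ) - m * q) ^ 2) = m * (q * (1 - q)) := by
  induction m with
  | zero => simp [binExp]
  | succ m ih =>
    rw [binExp_centered q m (fun x => x ^ 2)]
    have : ∀ k : ℕ, q * ((k - m * q) + (1 - q)) ^ 2 + (1 - q) * ((k - m * q) - q) ^ 2 =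
        ((k : ℝ) - m * q) ^ 2 + q * (1 - q) := fun k => by ring
    rw [binExp_congr this, binExp_add, ih, binExp_const]
    push_cast; ring

/-- One trial adds an independent centred increment ξ. In the expansion of the fourth power the
terms with Eξ and with E[ξ³] drop out, the latter because it multiplies a centred mean. With v =
q(1-q), the bound omits the exact term -6v²m. -/
lemma binExp_centered_four (q : ℝ) (m : ℕ) :
    binExp q m (fun k => ((k : ℝ) - m * q) ^ 4) ≤
      3 * (q * (1 - q)) ^ 2 * m ^ 2 + q * (1 - q) * m := by
  induction m with
  | zero => simp [binExp]
  | succ m ih =>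
    rw [binExp_centered q m (fun x => x ^ 4)]
    have : ∀ k : ℕ, q * ((k - m * q) + (1 - q)) ^ 4 + (1 - q) * ((k - m * q) - q) ^ 4 =
        ((k : ℝ) - m * q) ^ 4 + (6 * (q * (1 - q)) * ((k : ℝ) - m * q) ^ 2 +
          (4 * (q * (1 - q)) * (1 - 2 * q) * ((k : ℝ) - m * q) +
            q * (1 - q) * (1 - 3 * (q * (1 - q))))) := fun k => by ring
    rw [binExp_congr this, binExp_add, binExp_add, binExp_add, binExp_const_mul,
      binExp_const_mul, binExp_centered_sq, binExp_centered_one, binExp_const]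
    push_cast
    nlinarith [sq_nonneg (q * (1 - q))]

lemma binExp_centered_four_le {q : ℝ} (h0 : 0 ≤ q) (h1 : q ≤ 1) (m : ℕ) :
    binExp q m (fun k => ((k : ℝ) - m * q) ^ 4) ≤ (m : ℝ) ^ 2 := by
  refine (binExp_centered_four q m).trans ?_
  have hv : q * (1 - q) ≤ 1 / 4 := by nlinarith [sq_nonneg (q - 1 / 2)]
  have hv0 : 0 ≤ q * (1 - q) := mul_nonneg h0 (by linarith)
  have hm : (m : ℝ) ≤ (m : ℝ) ^ 2 := by exact_mod_cast Nat.le_self_pow (by norm_num) m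
  have h2 : (q * (1 - q)) ^ 2 ≤ 1 / 16 := by nlinarith
  nlinarith [mul_le_mul_of_nonneg_right h2 (sq_nonneg (m : ℝ)),
    mul_le_mul hv hm (by positivity) (by norm_num)]

/-- For u ≥ 0 one has u ≥ u² - u⁴/4. Taking u = |k - mq|/√m bounds the first absolute moment below
by the second and fourth. With v = q(1-q) ≤ 1/4 the fourth is at most 2vm², which leaves v√m -
v√m/2. -/
lemma sqrt_le_binExp_abs {q : ℝ} (h0 : 0 ≤ q) (h1 : q ≤ 1) (m : ℕ) :
    q * (1 - q) / 2 * √m ≤ binExp q m (fun k => |(k : ℝ) - m * q|) := by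
  rcases Nat.eq_zero_or_pos m with rfl | hm
  · simp [binExp]
  have hm1 : (1 : ℝ) ≤ m := by exact_mod_cast hm
  have hs : 0 < √(m : ℝ) := Real.sqrt_pos.mpr (by linarith)
  have hss : √(m : ℝ) ^ 2 = m := Real.sq_sqrt (by linarith)
  have hpt : ∀ k : ℕ, (1 / √m) * ((k : ℝ) - m * q) ^ 2 +
      (-(1 / (4 * √m ^ 3))) * ((k : ℝ) - m * q) ^ 4 ≤ |(k : ℝ) - m * q| := by
    intro k
    set y := |(k : ℝ) - m * q| with hy
    have hy0 : 0 ≤ y := abs_nonneg _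
    have e2 : ((k : ℝ) - m * q) ^ 2 = y ^ 2 := (sq_abs _).symm
    have e4 : ((k : ℝ) - m * q) ^ 4 = y ^ 4 := by
      rw [show ((k : ℝ) - m * q) ^ 4 = (((k : ℝ) - m * q) ^ 2) ^ 2 by ring, e2]; ring
    rw [e2, e4]
    obtain ⟨u, hu⟩ : ∃ u, y = u * √m := ⟨y / √m, by field_simp⟩
    have hu0 : 0 ≤ u := by
      by_contra h; push Not at h; nlinarith
    rw [hu]
    have : 1 / √m * (u * √m) ^ 2 + -(1 / (4 * √m ^ 3)) * (u * √m) ^ 4 =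
        (u ^ 2 - u ^ 4 / 4) * √(m : ℝ) := by field_simp; ring
    rw [this]
    refine mul_le_mul_of_nonneg_right ?_ hs.le
    nlinarith [mul_nonneg hu0 (mul_nonneg (by linarith : 0 ≤ u + 2) (sq_nonneg (u - 1))),
      mul_nonneg hu0 (sq_nonneg (u - 1)), mul_nonneg hu0 (mul_nonneg hu0 (sq_nonneg (u - 1)))]
  refine le_trans ?_ (binExp_mono h0 h1 m hpt)
  rw [binExp_add, binExp_const_mul, binExp_const_mul, binExp_centered_sq]
  have h4 := binExp_centered_four q m
  have hv : q * (1 - q) ≤ 1 / 4 := by nlinarith [sq_nonneg (q - 1 / 2)]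
  have hv0 : 0 ≤ q * (1 - q) := mul_nonneg h0 (by linarith)
  set v := q * (1 - q)
  have h4' : binExp q m (fun k => ((k : ℝ) - m * q) ^ 4) ≤ 2 * v * √(m : ℝ) ^ 4 := by
    refine h4.trans ?_
    have : √(m : ℝ) ^ 4 = (m : ℝ) ^ 2 := by
      rw [show √(m : ℝ) ^ 4 = (√(m : ℝ) ^ 2) ^ 2 by ring, hss]
    rw [this]
    have hm2 : (m : ℝ) ≤ (m : ℝ) ^ 2 := by nlinarith
    nlinarith [mul_le_mul_of_nonneg_left hm2 hv0,
      mul_le_mul_of_nonneg_right (mul_le_mul_of_nonneg_left hv hv0) (sq_nonneg (m : ℝ))]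
  have h5 : 1 / (4 * √(m : ℝ) ^ 3) * binExp q m (fun k => ((k : ℝ) - m * q) ^ 4) ≤
      1 / (4 * √(m : ℝ) ^ 3) * (2 * v * √(m : ℝ) ^ 4) :=
    mul_le_mul_of_nonneg_left h4' (by positivity)
  have h6 : 1 / (4 * √(m : ℝ) ^ 3) * (2 * v * √(m : ℝ) ^ 4) = v / 2 * √m := by
    field_simp; ring
  have h7 : 1 / √(m : ℝ) * (m * v) = v * √m := by
    nth_rewrite 2 [← hss]; field_simp
  rw [h7]
  nlinarith

/-- For a centred variable the negative part carries half of the mean absolute value. -/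
lemma sqrt_le_binExp_neg_part {q : ℝ} (h0 : 0 ≤ q) (h1 : q ≤ 1) (m : ℕ) :
    q * (1 - q) / 4 * √m ≤ binExp q m (fun k => max (m * q - (k : ℝ)) 0) := by
  have h := sqrt_le_binExp_abs h0 h1 m
  have e : ∀ k : ℕ, |(k : ℝ) - m * q| =
      2 * max (m * q - (k : ℝ)) 0 + ((k : ℝ) - m * q) := fun k => by
    rcases le_total (m * q) (k : ℝ) with hk | hk
    · rw [abs_of_nonneg (by linarith), max_eq_right (by linarith)]; ring
    · rw [abs_of_nonpos (by linarith), max_eq_left (by linarith)]; ring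
  rw [binExp_congr e, binExp_add, binExp_const_mul, binExp_centered_one] at h
  linarith

/-- The mean absolute deviation is at most the standard deviation. -/
lemma binExp_abs_le_sqrt {q : ℝ} (h0 : 0 ≤ q) (h1 : q ≤ 1) (m : ℕ) :
    binExp q m (fun k => |(k : ℝ) - m * q|) ≤ √m := by
  rcases Nat.eq_zero_or_pos m with rfl | hm
  · simp [binExp]
  have hs : 0 < √(m : ℝ) := Real.sqrt_pos.mpr (by exact_mod_cast hm)
  have hss : √(m : ℝ) ^ 2 = m := Real.sq_sqrt (by positivity)
  -- The arithmetic-geometric mean inequality, applied pointwise, plays the role of Cauchy-Schwarz.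
  have hpt : ∀ k : ℕ, |(k : ℝ) - m * q| ≤ 1 / (2 * √m) * ((k : ℝ) - m * q) ^ 2 + √m / 2 := by
    intro k
    rw [← sq_abs ((k : ℝ) - m * q), ← sub_nonneg]
    have : 1 / (2 * √m) * |(k : ℝ) - m * q| ^ 2 + √m / 2 - |(k : ℝ) - m * q| =
      (|(k : ℝ) - m * q| - √m) ^ 2 / (2 * √m) := by field_simp; ring
    rw [this]; positivity
  refine (binExp_mono h0 h1 m hpt).trans ?_
  rw [binExp_add, binExp_const_mul, binExp_centered_sq, binExp_const]
  have hv : q * (1 - q) ≤ 1 := by nlinarith [sq_nonneg (q - 1 / 2)]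
  have : 1 / (2 * √(m : ℝ)) * (m * (q * (1 - q))) = √m / 2 * (q * (1 - q)) := by
    nth_rewrite 2 [← hss]; field_simp
  rw [this]
  nlinarith

/-! ### Demand, long-run averages and existence of optimal levels -/

lemma arrivals_product (s : Finset ℕ) (T : ℕ) (H : Path) :
    arrivals (s ×ˢ Finset.range T) H = ∑ n ∈ s, demand T H n := by
  simp only [arrivals, demand, Finset.card_filter]
  exact Finset.sum_product _ _ _

lemma demand_eq_arrivals (T : ℕ) (H : Path) (n : ℕ) :
    demand T H n = arrivals ({n} ×ˢ Finset.range T) H := by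
  rw [arrivals_product, Finset.sum_singleton]

lemma continuous_demand (T n : ℕ) : Continuous fun H => demand T H n := by
  simp only [demand_eq_arrivals]
  exact continuous_arrivals _

lemma continuous_demand_cast (T n : ℕ) : Continuous fun H => (demand T H n : ℝ) :=
  continuous_of_discreteTopology.comp (continuous_demand T n)

lemma longRunAverage_ofReal (lam0 : unitInterval) {cost : ℕ → Path → ℝ}
    (hc : ∀ n, Continuous (cost n)) (h0 : ∀ n H, 0 ≤ cost n H) :
    longRunAverage lam0 (fun n H => ENNReal.ofReal (cost n H)) =
      limsup (fun N : ℕ => ENNReal.ofReal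
        ((∑ n ∈ Finset.range N, ∫ H, cost n H ∂(pathLaw lam0)) / N)) atTop := by
  unfold longRunAverage
  congr 1
  ext N
  rcases Nat.eq_zero_or_pos N with rfl | hN
  · simp
  rw [ENNReal.ofReal_div_of_pos (by exact_mod_cast hN), ENNReal.ofReal_natCast,
    ENNReal.ofReal_sum_of_nonneg fun n _ => integral_nonneg (h0 n)]
  congr 1
  refine Finset.sum_congr rfl fun n _ => ?_
  rw [ofReal_integral_eq_lintegral_ofReal (integrable_of_continuous lam0 (hc n))
    (Eventually.of_forall (h0 n))]

lemma isClosed_admissible {A : Set ℝ}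
    (hA : A = Set.range (fun m : ℕ => (m : ℝ)) ∨ A = Set.Ici 0) : IsClosed A := by
  rcases hA with rfl | rfl
  · exact Nat.isClosedEmbedding_coe_real.isClosed_range
  · exact isClosed_Ici

lemma nonneg_of_admissible {A : Set ℝ}
    (hA : A = Set.range (fun m : ℕ => (m : ℝ)) ∨ A = Set.Ici 0) {x : ℝ} (hx : x ∈ A) : 0 ≤ x := by
  rcases hA with rfl | rfl
  · obtain ⟨m, rfl⟩ := hx; exact m.cast_nonneg
  · exact hx

lemma natCast_admissible {A : Set ℝ}
    (hA : A = Set.range (fun m : ℕ => (m : ℝ)) ∨ A = Set.Ici 0) (m : ℕ) : (m : ℝ) ∈ A := by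
  rcases hA with rfl | rfl
  · exact ⟨m, rfl⟩
  · exact Set.mem_Ici.mpr m.cast_nonneg

/-- A lower semicontinuous function attains its minimum on the compact set A ∩ [0, R]; beyond R the
point 0 does at least as well. Continuity would be too much to ask, as the constant-order cost takes
the value ∞. -/
lemma exists_isOptimal {A : Set ℝ}
    (hA : A = Set.range (fun m : ℕ => (m : ℝ)) ∨ A = Set.Ici 0) {f φ : ℝ → ℝ≥0∞}
    (hf : ∀ x, 0 ≤ x → f x = φ x) (hφ : LowerSemicontinuous φ) {R : ℝ} (hR0 : 0 ≤ R)
    (hR : ∀ x, R < x → φ 0 ≤ φ x) : ∃ x, IsOptimal A f x := by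
  have h0A : (0 : ℝ) ∈ A := by simpa using natCast_admissible hA 0
  have hcomp : IsCompact (A ∩ Set.Icc 0 R) := isCompact_Icc.inter_left (isClosed_admissible hA)
  obtain ⟨x, hx, hmin⟩ := (hφ.lowerSemicontinuousOn (A ∩ Set.Icc 0 R)).exists_isMinOn
    (show (A ∩ Set.Icc 0 R).Nonempty from ⟨0, h0A, le_rfl, hR0⟩) hcomp
  refine ⟨x, hx.1, isMinOn_iff.mpr fun y hy => ?_⟩
  have hy0 := nonneg_of_admissible hA hy
  rw [hf x hx.2.1, hf y hy0]
  rcases le_or_gt y R with hyR | hyR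
  · exact isMinOn_iff.mp hmin y ⟨hy, hy0, hyR⟩
  · exact le_trans (isMinOn_iff.mp hmin 0 ⟨h0A, le_rfl, hR0⟩) (hR y hyR)

/-! ### The newsvendor cost -/

lemma sum_overage (lam0 : unitInterval) (m : ℕ) {S : ℝ} (hS : 0 ≤ S) :
    ∑ k ∈ Finset.range (⌊S⌋₊ + 1), (S - k) * binomialProb lam0 m k =
      binExp (1 - (lam0 : ℝ)) m (fun k => max (S - k) 0) := by
  -- The cutoff exceeds both `m` and ⌊S⌋, whichever is larger; the added terms have zero overage.
  rw [binExp_eq_sum lam0 m _ (R := ⌊S⌋₊ + 1 + m) (by omega)]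
  rw [← Finset.sum_subset (Finset.range_mono (Nat.le_add_right (⌊S⌋₊ + 1) m))]
  · refine Finset.sum_congr rfl fun k hk => ?_
    have : (k : ℝ) ≤ S := (Nat.le_floor_iff hS).mp (by
      have := Finset.mem_range.mp hk; omega)
    rw [max_eq_left (by linarith)]
  · intro k _ hk
    have : S < k := (Nat.floor_lt hS).mp (by
      have := Finset.mem_range.not.mp hk; omega)
    rw [max_eq_right (by linarith), zero_mul]

lemma sum_underage (lam0 : unitInterval) (m : ℕ) {S : ℝ} (hS : 0 ≤ S) :
    ∑ k ∈ Finset.Icc (⌊S⌋₊ + 1) m, (k - S) * binomialProb lam0 m k =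
      binExp (1 - (lam0 : ℝ)) m (fun k => max (k - S) 0) := by
  rw [binExp_eq_sum lam0 m _ (R := m + 1) (by omega)]
  rw [← Finset.sum_subset (s₁ := Finset.Icc (⌊S⌋₊ + 1) m) (s₂ := Finset.range (m + 1))]
  · refine Finset.sum_congr rfl fun k hk => ?_
    have : S < k := (Nat.floor_lt hS).mp (by
      have := (Finset.mem_Icc.mp hk).1; omega)
    rw [max_eq_left (by linarith)]
  · intro k hk
    have := (Finset.mem_Icc.mp hk).2
    exact Finset.mem_range.mpr (by omega)
  · intro k hk hk'
    have hkm := Finset.mem_range.mp hk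
    have : (k : ℝ) ≤ S := (Nat.le_floor_iff hS).mp (by
      by_contra hc
      exact hk' (Finset.mem_Icc.mpr ⟨by omega, by omega⟩))
    rw [max_eq_right (by linarith), zero_mul]

/-- The expected newsvendor cost of the level `S` against `m` Bernoulli trials. -/
noncomputable def newsvendorCost (q : ℝ) (m : ℕ) (h b S : ℝ) : ℝ :=
  binExp q m fun k => h * max (S - k) 0 + b * max (k - S) 0

lemma pipelineCost_eq (lam0 : unitInterval) (L T : ℕ) (h b : ℝ) {S : ℝ} (hS : 0 ≤ S) :
    pipelineCost lam0 L T h b S = newsvendorCost (1 - (lam0 : ℝ)) ((L + 1) * T) h b S := by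
  rw [pipelineCost, sum_overage lam0 _ hS, sum_underage lam0 _ hS, newsvendorCost, binExp_add,
    binExp_const_mul, binExp_const_mul]

section

variable {q h b : ℝ}

lemma continuous_newsvendorCost (q : ℝ) (m : ℕ) (h b : ℝ) :
    Continuous (newsvendorCost q m h b) :=
  continuous_binExp q m fun k => by fun_prop

lemma newsvendorCost_nonneg (h0 : 0 ≤ q) (h1 : q ≤ 1) (hh : 0 ≤ h) (hb : 0 ≤ b) (m : ℕ) (S : ℝ) :
    0 ≤ newsvendorCost q m h b S := by
  rw [← binExp_const q m 0]
  exact binExp_mono h0 h1 m fun k => by positivity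

/-- Already pointwise: for k ≤ m the level 0 pays at most b m, and past the threshold holding alone
costs h(S - m) ≥ b m. -/
lemma newsvendorCost_zero_le (h0 : 0 ≤ q) (h1 : q ≤ 1) (hh : 0 < h) (hb : 0 ≤ b) (m : ℕ) {S : ℝ}
    (hS : m + b * m / h < S) : newsvendorCost q m h b 0 ≤ newsvendorCost q m h b S := by
  refine binExp_mono_of_le h0 h1 m fun k hk => ?_
  have hkm : (k : ℝ) ≤ m := by exact_mod_cast hk
  have hk0 : (0 : ℝ) ≤ k := k.cast_nonneg
  rw [max_eq_right (by linarith), max_eq_left (by linarith)]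
  have h2 : b * m ≤ h * (S - m) := by
    have : b * m / h ≤ S - m := by linarith
    rwa [div_le_iff₀ hh, mul_comm (S - _)] at this
  have h3 : h * (S - m) ≤ h * max (S - k) 0 :=
    mul_le_mul_of_nonneg_left (le_max_of_le_left (by linarith)) hh.le
  have h4 : b * k ≤ b * m := mul_le_mul_of_nonneg_left hkm hb
  have h5 : 0 ≤ b * max ((k : ℝ) - S) 0 := by positivity
  linarith

/-- Rounding the mean up makes the test level admissible in the integer case too, at the price of
the `+ 1`. -/
lemma newsvendorCost_ceil_le (h0 : 0 ≤ q) (h1 : q ≤ 1) (hh : 0 ≤ h) (hb : 0 ≤ b) (m : ℕ) :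
    newsvendorCost q m h b ⌈(m : ℝ) * q⌉₊ ≤ (h + b) * (√m + 1) := by
  have hc1 : (m : ℝ) * q ≤ ⌈(m : ℝ) * q⌉₊ := Nat.le_ceil _
  have hc2 : (⌈(m : ℝ) * q⌉₊ : ℝ) < m * q + 1 := Nat.ceil_lt_add_one (by positivity)
  have hpt : ∀ k : ℕ, h * max ((⌈(m : ℝ) * q⌉₊ : ℝ) - k) 0 + b * max (k - (⌈(m : ℝ) * q⌉₊ : ℝ)) 0 ≤
      (h + b) * (|(k : ℝ) - m * q| + 1) := by
    intro k
    have a1 := le_abs_self ((k : ℝ) - m * q)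
    have a2 := neg_abs_le ((k : ℝ) - m * q)
    have a3 := abs_nonneg ((k : ℝ) - m * q)
    rw [add_mul]
    exact add_le_add (mul_le_mul_of_nonneg_left (max_le (by linarith) (by linarith)) hh)
      (mul_le_mul_of_nonneg_left (max_le (by linarith) (by linarith)) hb)
  refine (binExp_mono h0 h1 m hpt).trans ?_
  rw [binExp_const_mul, binExp_add, binExp_const]
  exact mul_le_mul_of_nonneg_left (add_le_add_left (binExp_abs_le_sqrt h0 h1 m) 1) (by linarith)

/-- With X the binomial variable and μ its mean, |μ - S| ≤ E|X - S| gives E|X - μ| ≤ 2E|X - S|. So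
no level S can beat half of the mean absolute deviation, weighted by min(h, b). -/
lemma sqrt_le_newsvendorCost (h0 : 0 ≤ q) (h1 : q ≤ 1) (hh : 0 ≤ h) (hb : 0 ≤ b) (m : ℕ) (S : ℝ) :
    min h b * (q * (1 - q) / 4 * √m) ≤ newsvendorCost q m h b S := by
  have hE : binExp q m (fun k => |(k : ℝ) - m * q|) ≤ 2 * binExp q m (fun k => |(k : ℝ) - S|) := by
    have e1 : |m * q - S| ≤ binExp q m (fun k => |(k : ℝ) - S|) := by
      have e : binExp q m (fun k => (k : ℝ) - S) = m * q - S := by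
        have : ∀ k : ℕ, (k : ℝ) - S = ((k : ℝ) - m * q) + (m * q - S) := fun k => by ring
        rw [binExp_congr this, binExp_add, binExp_centered_one, binExp_const, zero_add]
      refine abs_le.mpr ⟨?_, ?_⟩
      · rw [← e, neg_le, ← neg_one_mul, ← binExp_const_mul]
        exact binExp_mono h0 h1 m fun k => by
          rw [neg_one_mul]; exact neg_le_abs _
      · rw [← e]
        exact binExp_mono h0 h1 m fun k => le_abs_self _
    have e2 : binExp q m (fun k => |(k : ℝ) - m * q|) ≤
        binExp q m (fun k => |(k : ℝ) - S| + |m * q - S|) :=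
      binExp_mono h0 h1 m fun k => by
        rw [abs_sub_comm (m * q) S]; exact abs_sub_le _ _ _
    rw [binExp_add, binExp_const] at e2
    linarith
  have hlow := sqrt_le_binExp_abs h0 h1 m
  have hm0 : 0 ≤ min h b := le_min hh hb
  calc min h b * (q * (1 - q) / 4 * √m)
      ≤ min h b * binExp q m (fun k => |(k : ℝ) - S|) :=
        mul_le_mul_of_nonneg_left (by linarith) hm0
    _ = binExp q m (fun k => min h b * |(k : ℝ) - S|) := (binExp_const_mul _ _ _ _).symm
    _ ≤ newsvendorCost q m h b S := by
        refine binExp_mono h0 h1 m fun k => ?_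
        rcases le_total (k : ℝ) S with hk | hk
        · rw [abs_of_nonpos (by linarith), max_eq_left (by linarith), max_eq_right (by linarith)]
          nlinarith [min_le_left h b]
        · rw [abs_of_nonneg (by linarith), max_eq_right (by linarith), max_eq_left (by linarith)]
          nlinarith [min_le_right h b]

end

/-! ### The backorder system under a base-stock policy -/

/-- The order lifts the position to S, and a receipt only moves units from the pipeline into stock,
so the demand is the only loss. -/
lemma backorderStep_position (L : ℕ) (S : ℝ) (d : ℕ) (s : BackorderState) :
    (backorderStep L S d s).net + ∑ l ∈ Finset.range L, (backorderStep L S d s).orders l = S - d := by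
  set q := Function.update s.orders L (S - s.net - ∑ l ∈ Finset.range L, s.orders l) with hq
  change s.net + q 0 - d + ∑ l ∈ Finset.range L, q (l + 1) = S - d
  have h1 := Finset.sum_range_succ' q L
  rw [Finset.sum_range_succ] at h1
  have h2 : ∑ l ∈ Finset.range L, q l = ∑ l ∈ Finset.range L, s.orders l :=
    Finset.sum_congr rfl fun l hl => by
      rw [hq, Function.update_of_ne (Finset.mem_range.mp hl).ne]
  have h3 : q L = S - s.net - ∑ l ∈ Finset.range L, s.orders l := by rw [hq, Function.update_self]
  linarith

/-- The quantity ordered at the beginning of cycle `n`: the demand of the preceding cycle. -/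
def replenishment (T : ℕ) (H : Path) (n : ℕ) : ℕ := if n = 0 then 0 else demand T H (n - 1)

lemma backorder_order (L T : ℕ) (S : ℝ) (H : Path) (n : ℕ) :
    S - (backorderState L T S H n).net -
      ∑ l ∈ Finset.range L, (backorderState L T S H n).orders l = replenishment T H n := by
  cases n with
  | zero => simp [backorderState, replenishment]
  | succ n =>
    have := backorderStep_position L S (demand T H n) (backorderState L T S H n)
    simp only [backorderState, replenishment, Nat.add_sub_cancel]
    rw [if_neg (Nat.succ_ne_zero n)]
    linarith

/-- An order due in `l` cycles was placed in cycle n + l - L. Truncation sends cycles before the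
start to cycle 0, whose order is 0, which matches the empty initial pipeline. -/
lemma backorder_orders (L T : ℕ) (S : ℝ) (H : Path) (n l : ℕ) (hl : l < L) :
    (backorderState L T S H n).orders l = replenishment T H (n + l - L) := by
  induction n generalizing l with
  | zero =>
    have : 0 + l - L = 0 := by omega
    rw [this]
    simp [backorderState, replenishment]
  | succ n ih =>
    simp only [backorderState, backorderStep]
    rcases eq_or_ne (l + 1) L with h | h
    · subst h
      rw [Function.update_self, backorder_order]
      congr 2; omega
    · rw [Function.update_of_ne h, ih (l + 1) (by omega)]
      congr 2; omega

/-- The order received in cycle n equals the demand of cycle n - (L+1), so it cancels the oldest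
term of the window while the new demand enters. In the first cycles the window is truncated and
nothing is received. -/
lemma backorder_net (L T : ℕ) (S : ℝ) (H : Path) (n : ℕ) :
    (backorderState L T S H n).net =
      S - ∑ i ∈ Finset.Ico (n - (L + 1)) n, (demand T H i : ℝ) := by
  induction n with
  | zero => simp [backorderState]
  | succ n ih =>
    have hq : Function.update (backorderState L T S H n).orders L
        (S - (backorderState L T S H n).net -
          ∑ l ∈ Finset.range L, (backorderState L T S H n).orders l) 0 =
        replenishment T H (n - L) := by
      rcases Nat.eq_zero_or_pos L with h | h
      · subst h
        rw [Function.update_self, backorder_order, Nat.sub_zero]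
      · rw [Function.update_of_ne h.ne, backorder_orders L T S H n 0 h, Nat.add_zero]
    simp only [backorderState, backorderStep]
    rw [hq, ih, Finset.sum_Ico_succ_top (by omega)]
    unfold replenishment
    split_ifs with h0
    · have e1 : n - (L + 1) = 0 := by omega
      have e2 : n + 1 - (L + 1) = 0 := by omega
      rw [e1, e2]; push_cast; ring
    · have e2 : n + 1 - (L + 1) = n - (L + 1) + 1 := by omega
      have e3 : n - L - 1 = n - (L + 1) := by omega
      rw [e2, e3, Finset.sum_eq_sum_Ico_succ_bot (show n - (L + 1) < n by omega)]
      ring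

lemma backorderCost_eq (lam0 : unitInterval) (L T : ℕ) {h b : ℝ} (hh : 0 ≤ h) (hb : 0 ≤ b)
    (S : ℝ) : backorderCost lam0 L T h b S =
      ENNReal.ofReal (newsvendorCost (1 - (lam0 : ℝ)) ((L + 1) * T) h b S) := by
  unfold backorderCost
  have hcont : ∀ n, Continuous fun H => (backorderState L T S H (n + 1)).net := fun n => by
    simp only [backorder_net]
    exact continuous_const.sub (continuous_finsetSum _ fun i _ => continuous_demand_cast T i)
  refine (longRunAverage_ofReal lam0 (cost := fun n H =>
    h * max (backorderState L T S H (n + 1)).net 0 +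
      b * max (-(backorderState L T S H (n + 1)).net) 0)
    (fun n => ?_) (fun n H => by positivity)).trans ?_
  · have := hcont n
    fun_prop
  refine Tendsto.limsup_eq ((ENNReal.continuous_ofReal.tendsto _).comp ?_)
  -- Once n ≥ L the window holds L+1 full cycles, so the expected cost is constant from there on and
  -- the Cesàro means converge to it.
  have hev : Tendsto (fun n => ∫ H, (h * max (backorderState L T S H (n + 1)).net 0 +
      b * max (-(backorderState L T S H (n + 1)).net) 0) ∂(pathLaw lam0)) atTop
      (𝓝 (newsvendorCost (1 - (lam0 : ℝ)) ((L + 1) * T) h b S)) := by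
    refine tendsto_const_nhds.congr' ?_
    filter_upwards [eventually_ge_atTop L] with n hn
    have key := integral_comp_arrivals lam0 (Finset.Ico (n - L) (n + 1) ×ˢ Finset.range T)
      (fun k => h * max (S - k) 0 + b * max (k - S) 0)
    rw [Finset.card_product, Nat.card_Ico, Finset.card_range,
      show n + 1 - (n - L) = L + 1 by omega] at key
    rw [newsvendorCost, ← key]
    refine integral_congr_ae (Eventually.of_forall fun H => ?_)
    simp only [backorder_net, arrivals_product, Nat.cast_sum, neg_sub]
    rw [show n + 1 - (L + 1) = n - L by omega]
  simpa [div_eq_inv_mul] using hev.cesaro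

section

variable {A : Set ℝ} {h b : ℝ}

lemma exists_isOptimal_backorderCost (lam0 : unitInterval) (L T : ℕ)
    (hA : A = Set.range (fun m : ℕ => (m : ℝ)) ∨ A = Set.Ici 0) (hh : 0 < h) (hb : 0 ≤ b) :
    ∃ S, IsOptimal A (backorderCost lam0 L T h b) S := by
  have h0 : 0 ≤ 1 - (lam0 : ℝ) := by linarith [lam0.2.2]
  have h1 : 1 - (lam0 : ℝ) ≤ 1 := by linarith [lam0.2.1]
  exact exists_isOptimal hA (fun S _ => backorderCost_eq lam0 L T hh.le hb S)
    (ENNReal.continuous_ofReal.comp (continuous_newsvendorCost _ _ h b)).lowerSemicontinuous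
    (R := ((L + 1) * T : ℕ) + b * ((L + 1) * T : ℕ) / h) (by positivity)
    fun S hS => ENNReal.ofReal_le_ofReal (newsvendorCost_zero_le h0 h1 hh hb _ hS)

/-- Optimality is used only for the upper bound; the lower bound holds at every level. -/
lemma pipelineCost_isTheta (lam0 : unitInterval) (L : ℕ) (hlam0 : 0 < lam0) (hlam1 : lam0 < 1)
    (hA : A = Set.range (fun m : ℕ => (m : ℝ)) ∨ A = Set.Ici 0) (hh : 0 < h) (hb : 0 < b)
    {S : ℕ → ℝ} (hS : ∀ T : ℕ, 1 ≤ T → IsOptimal A (backorderCost lam0 L T h b) (S T)) :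
    (fun T : ℕ => pipelineCost lam0 L T h b (S T)) =Θ[atTop] (fun T : ℕ => √(T : ℝ)) := by
  have hl0 : (0 : ℝ) < lam0 := hlam0
  have hl1 : (lam0 : ℝ) < 1 := hlam1
  set q := 1 - (lam0 : ℝ) with hq
  have h0 : 0 < q := by linarith
  have h1 : q < 1 := by linarith
  have hsq : ∀ T : ℕ, √(((L + 1) * T : ℕ) : ℝ) = √((L : ℝ) + 1) * √(T : ℝ) := fun T => by
    push_cast; exact Real.sqrt_mul (by positivity) _
  have hcost : ∀ T : ℕ, 1 ≤ T →
      pipelineCost lam0 L T h b (S T) = newsvendorCost q ((L + 1) * T) h b (S T) := fun T hT =>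
    pipelineCost_eq lam0 L T h b (nonneg_of_admissible hA (hS T hT).1)
  have hnn : ∀ T : ℕ, 0 ≤ newsvendorCost q ((L + 1) * T) h b (S T) := fun T =>
    newsvendorCost_nonneg h0.le h1.le hh.le hb.le _ _
  constructor
  · refine IsBigO.of_bound ((h + b) * (√((L : ℝ) + 1) + 1)) ?_
    filter_upwards [eventually_ge_atTop 1] with T hT
    rw [hcost T hT, Real.norm_of_nonneg (hnn T), Real.norm_of_nonneg (Real.sqrt_nonneg _)]
    have hopt := isMinOn_iff.mp (hS T hT).2 _ (natCast_admissible hA ⌈(((L + 1) * T : ℕ) : ℝ) * q⌉₊)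
    rw [backorderCost_eq lam0 L T hh.le hb.le, backorderCost_eq lam0 L T hh.le hb.le,
      ENNReal.ofReal_le_ofReal_iff (newsvendorCost_nonneg h0.le h1.le hh.le hb.le _ _)] at hopt
    refine hopt.trans ((newsvendorCost_ceil_le h0.le h1.le hh.le hb.le _).trans ?_)
    rw [hsq, mul_assoc]
    refine mul_le_mul_of_nonneg_left ?_ (by linarith)
    have : 1 ≤ √(T : ℝ) := Real.one_le_sqrt.mpr (by exact_mod_cast hT)
    linarith
  · have hc : 0 < min h b * (q * (1 - q) / 4) :=
      mul_pos (lt_min hh hb) (div_pos (mul_pos h0 (by linarith)) (by norm_num))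
    refine IsBigO.of_bound (min h b * (q * (1 - q) / 4))⁻¹ ?_
    filter_upwards [eventually_ge_atTop 1] with T hT
    rw [hcost T hT, Real.norm_of_nonneg (hnn T), Real.norm_of_nonneg (Real.sqrt_nonneg _),
      inv_mul_eq_div, le_div_iff₀ hc]
    refine le_trans ?_ (sqrt_le_newsvendorCost h0.le h1.le hh.le hb.le _ (S T))
    rw [hsq]
    have : 1 ≤ √((L : ℝ) + 1) := Real.one_le_sqrt.mpr (by simp)
    have h2 : √(T : ℝ) ≤ √((L : ℝ) + 1) * √(T : ℝ) :=
      le_mul_of_one_le_left (Real.sqrt_nonneg _) this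
    nlinarith

end

/-! ### The lost-sales system under a constant-order policy -/

lemma constantStart_succ (T : ℕ) (c : ℝ) (H : Path) (n : ℕ) :
    constantStart T c H (n + 1) = max (constantStart T c H n - demand T H n) 0 + c := by
  rw [constantStart]
  congr 1
  rcases le_total (constantStart T c H n) (demand T H n) with h | h
  · rw [min_eq_left h, max_eq_right (by linarith), sub_self]
  · rw [min_eq_right h, max_eq_left (by linarith)]

lemma continuous_constantStart_uncurry (T n : ℕ) :
    Continuous fun z : ℝ × Path => constantStart T z.1 z.2 n := by
  induction n with
  | zero => exact continuous_fst
  | succ n ih =>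
    simp only [constantStart_succ]
    have := (continuous_demand_cast T n).comp (continuous_snd (X := ℝ) (Y := Path))
    exact ((ih.sub this).max continuous_const).add continuous_fst

lemma continuous_constantStart (T : ℕ) (c : ℝ) (n : ℕ) :
    Continuous fun H => constantStart T c H n :=
  (continuous_constantStart_uncurry T n).comp (Continuous.prodMk_right c)

lemma le_constantStart (T : ℕ) (c : ℝ) (H : Path) (n : ℕ) : c ≤ constantStart T c H n := by
  cases n with
  | zero => exact le_rfl
  | succ n => rw [constantStart_succ]; linarith [le_max_right (constantStart T c H n - demand T H n) 0]

/-- The inventory before cycle `n` ignores the arrivals from cycle `n` on; this yields its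
independence of the demand of cycle `n`. -/
lemma constantStart_update (T : ℕ) (c : ℝ) (H : Path) {n : ℕ} {a : ℕ × ℕ} (ha : n ≤ a.1)
    (b : Bool) : constantStart T c (Function.update H a b) n = constantStart T c H n := by
  induction n with
  | zero => rfl
  | succ n ih =>
    rw [constantStart_succ, constantStart_succ, ih (by omega), demand_eq_arrivals,
      demand_eq_arrivals, arrivals_update]
    simp only [Finset.mem_product, Finset.mem_singleton, not_and]
    intro h; omega

section

variable (lam0 : unitInterval) (T : ℕ) (c : ℝ)

lemma integral_constantStart_succ {g : ℝ → ℝ} (hg : Continuous g) (n : ℕ) :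
    ∫ H, g (constantStart T c H (n + 1)) ∂(pathLaw lam0) =
      ∫ H, binExp (1 - (lam0 : ℝ)) T (fun k => g (max (constantStart T c H n - k) 0 + c))
        ∂(pathLaw lam0) := by
  have key := integral_arrivals lam0 ({n} ×ˢ Finset.range T)
    (F := fun H k => g (max (constantStart T c H n - k) 0 + c))
    (fun k => hg.comp ((((continuous_constantStart T c n).sub continuous_const).max
      continuous_const).add continuous_const))
    (fun a ha b H k => by
      rw [constantStart_update]
      simp only [Finset.mem_product, Finset.mem_singleton] at ha
      exact ha.1.ge)
  rw [Finset.card_product, Finset.card_singleton, Finset.card_range, one_mul] at key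
  rw [← key]
  simp only [constantStart_succ, demand_eq_arrivals]

/-- The chain starts at its smallest state c, and its transition kernel maps monotone functions to
monotone functions, so it increases stochastically. -/
lemma integral_constantStart_mono {g : ℝ → ℝ} (hg : Continuous g) (hmono : Monotone g) (n : ℕ) :
    ∫ H, g (constantStart T c H n) ∂(pathLaw lam0) ≤
      ∫ H, g (constantStart T c H (n + 1)) ∂(pathLaw lam0) := by
  have h0 : 0 ≤ 1 - (lam0 : ℝ) := by linarith [lam0.2.2]
  have h1 : 1 - (lam0 : ℝ) ≤ 1 := by linarith [lam0.2.1]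
  induction n generalizing g with
  | zero =>
    refine integral_mono (integrable_of_continuous lam0 (hg.comp (continuous_constantStart T c 0)))
      (integrable_of_continuous lam0 (hg.comp (continuous_constantStart T c 1))) fun H => ?_
    exact hmono (le_constantStart T c H 1)
  | succ n ih =>
    rw [integral_constantStart_succ lam0 T c hg n, integral_constantStart_succ lam0 T c hg (n + 1)]
    refine ih (g := fun x => binExp (1 - (lam0 : ℝ)) T fun k => g (max (x - k) 0 + c)) ?_ ?_
    · exact continuous_binExp _ _ fun k => by fun_prop
    · intro x y hxy
      exact binExp_mono h0 h1 T fun k => hmono (by gcongr)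

/-- The expected inventory left at the end of cycle `n - 1` (zero for `n = 0`). -/
noncomputable def meanLeftover (n : ℕ) : ℝ := ∫ H, constantStart T c H n ∂(pathLaw lam0) - c

lemma meanLeftover_zero : meanLeftover lam0 T c 0 = 0 := by
  simp [meanLeftover, constantStart]

lemma monotone_meanLeftover : Monotone (meanLeftover lam0 T c) :=
  monotone_nat_of_le_succ fun n =>
    sub_le_sub_right (integral_constantStart_mono lam0 T c continuous_id monotone_id n) c

lemma meanLeftover_nonneg (n : ℕ) : 0 ≤ meanLeftover lam0 T c n := by
  rw [← meanLeftover_zero lam0 T c]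
  exact monotone_meanLeftover lam0 T c n.zero_le

lemma continuous_meanLeftover (n : ℕ) : Continuous fun c => meanLeftover lam0 T c n := by
  have := continuous_parametric_integral_of_continuous (μ := pathLaw lam0)
    (f := fun c H => constantStart T c H n) (continuous_constantStart_uncurry T n)
    (isCompact_univ (X := Path))
  simp only [Measure.restrict_univ] at this
  exact this.sub continuous_id

lemma meanLeftover_eq_integral (n : ℕ) :
    meanLeftover lam0 T c n = ∫ H, (constantStart T c H n - c) ∂(pathLaw lam0) := by
  rw [integral_sub (integrable_of_continuous lam0 (continuous_constantStart T c n))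
    (integrable_const c)]
  simp [meanLeftover]

lemma integral_demand (n : ℕ) :
    ∫ H, (demand T H n : ℝ) ∂(pathLaw lam0) = T * (1 - (lam0 : ℝ)) := by
  have key := integral_comp_arrivals lam0 ({n} ×ˢ Finset.range T) (fun k => (k : ℝ))
  rw [Finset.card_product, Finset.card_singleton, Finset.card_range, one_mul] at key
  simp only [demand_eq_arrivals, key]
  have : ∀ k : ℕ, (k : ℝ) = (k - T * (1 - (lam0 : ℝ))) + T * (1 - (lam0 : ℝ)) := fun k => by ring
  rw [binExp_congr this, binExp_add, binExp_centered_one, binExp_const, zero_add]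

/-- With I the inventory at the start of a cycle, sales are I_n + c - I_{n+1}. The mean lost sales
are therefore Tq - c plus an increment of the mean leftover, which telescopes over cycles. -/
lemma integral_constant_cycleCost (h p : ℝ) (n : ℕ) :
    ∫ H, (h * (constantStart T c H n - min (constantStart T c H n) (demand T H n)) +
      p * (demand T H n - min (constantStart T c H n) (demand T H n))) ∂(pathLaw lam0) =
      h * meanLeftover lam0 T c (n + 1) + p * (T * (1 - (lam0 : ℝ)) - c) +
        p * (meanLeftover lam0 T c (n + 1) - meanLeftover lam0 T c n) := by
  have e : ∀ H, h * (constantStart T c H n - min (constantStart T c H n) (demand T H n)) +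
      p * (demand T H n - min (constantStart T c H n) (demand T H n)) =
      ((h + p) * constantStart T c H (n + 1) + p * demand T H n) +
        ((-p) * constantStart T c H n + -((h + p) * c)) := fun H => by
    rw [constantStart]; ring
  have i1 := continuous_constantStart T c (n + 1)
  have i2 := continuous_constantStart T c n
  have i3 := continuous_demand_cast T n
  simp only [e]
  rw [integral_add, integral_add, integral_add, integral_const_mul, integral_const_mul,
    integral_const_mul, integral_demand]
  · simp only [meanLeftover, integral_const, probReal_univ, one_smul]
    ring
  all_goals exact integrable_of_continuous lam0 (by fun_prop)

/-- The average expected cost over the first `N` cycles, in terms of the expected leftovers. -/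
lemma constantCost_eq_limsup {h p : ℝ} (hh : 0 ≤ h) (hp : 0 ≤ p) :
    constantCost lam0 T h p c = limsup (fun N : ℕ => ENNReal.ofReal
      ((h * ∑ n ∈ Finset.range N, meanLeftover lam0 T c (n + 1) +
        N * (p * (T * (1 - (lam0 : ℝ)) - c)) + p * meanLeftover lam0 T c N) / N)) atTop := by
  unfold constantCost
  refine (longRunAverage_ofReal lam0 (cost := fun n H =>
    h * (constantStart T c H n - min (constantStart T c H n) (demand T H n)) +
      p * (demand T H n - min (constantStart T c H n) (demand T H n)))
    (fun n => ?_) (fun n H => ?_)).trans ?_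
  · have := continuous_constantStart T c n
    have := continuous_demand_cast T n
    fun_prop
  · exact add_nonneg (mul_nonneg hh (sub_nonneg.mpr (min_le_left _ _)))
      (mul_nonneg hp (sub_nonneg.mpr (min_le_right _ _)))
  · congr 1
    ext N
    congr 2
    simp only [integral_constant_cycleCost]
    rw [Finset.sum_add_distrib, Finset.sum_add_distrib, ← Finset.mul_sum,
      ← Finset.mul_sum (f := fun n => meanLeftover lam0 T c (n + 1) - meanLeftover lam0 T c n),
      Finset.sum_range_sub, meanLeftover_zero, sub_zero]
    simp

lemma sub_mul_le_sum_meanLeftover (m N : ℕ) :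
    ((N : ℝ) - m) * meanLeftover lam0 T c m ≤
      ∑ n ∈ Finset.range N, meanLeftover lam0 T c (n + 1) := by
  have hm := meanLeftover_nonneg lam0 T c m
  induction N with
  | zero =>
    simp only [Finset.range_zero, Finset.sum_empty]
    have : (0 : ℝ) ≤ m := m.cast_nonneg
    push_cast; nlinarith
  | succ N ih =>
    rw [Finset.sum_range_succ]
    have hN := meanLeftover_nonneg lam0 T c (N + 1)
    rcases le_or_gt m (N + 1) with h | h
    · have := monotone_meanLeftover lam0 T c h
      push_cast; linarith
    · have h2 : ((N : ℝ) + 1) ≤ m := by exact_mod_cast h.le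
      have h3 : 0 ≤ ∑ n ∈ Finset.range N, meanLeftover lam0 T c (n + 1) :=
        Finset.sum_nonneg fun n _ => meanLeftover_nonneg lam0 T c (n + 1)
      push_cast; nlinarith

lemma ofReal_le_constantCost {h p : ℝ} (hh : 0 ≤ h) (hp : 0 ≤ p) (m : ℕ) :
    ENNReal.ofReal (h * meanLeftover lam0 T c m + p * (T * (1 - (lam0 : ℝ)) - c)) ≤
      constantCost lam0 T h p c := by
  set e := meanLeftover lam0 T c with he
  set r := p * (T * (1 - (lam0 : ℝ)) - c) with hr
  have hlim : Tendsto (fun N : ℕ => ENNReal.ofReal (h * e m * (1 - m / N) + r)) atTop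
      (𝓝 (ENNReal.ofReal (h * e m + r))) := by
    refine (ENNReal.continuous_ofReal.tendsto _).comp ?_
    have h1 := tendsto_const_div_atTop_nhds_zero_nat (m : ℝ)
    have h2 := ((h1.const_sub 1).const_mul (h * e m)).add_const r
    simpa using h2
  rw [← hlim.limsup_eq, constantCost_eq_limsup lam0 T c hh hp]
  refine limsup_le_limsup ?_
  filter_upwards [eventually_ge_atTop 1] with N hN
  have hN0 : (0 : ℝ) < N := by exact_mod_cast hN
  refine ENNReal.ofReal_le_ofReal ?_
  rw [le_div_iff₀ hN0]
  have h1 := mul_le_mul_of_nonneg_left (sub_mul_le_sum_meanLeftover lam0 T c m N) hh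
  have h2 := mul_nonneg hp (meanLeftover_nonneg lam0 T c N)
  have h3 : (h * e m * (1 - m / N) + r) * N = h * ((N - m) * e m) + N * r := by
    field_simp
  rw [h3]
  linarith

lemma constantCost_le_ofReal {h p M : ℝ} (hh : 0 ≤ h) (hp : 0 ≤ p)
    (hM : ∀ n, meanLeftover lam0 T c n ≤ M) :
    constantCost lam0 T h p c ≤ ENNReal.ofReal (h * M + p * (T * (1 - (lam0 : ℝ)) - c)) := by
  set r := p * (T * (1 - (lam0 : ℝ)) - c) with hr
  have hlim : Tendsto (fun N : ℕ => ENNReal.ofReal (h * M + r + p * M / N)) atTop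
      (𝓝 (ENNReal.ofReal (h * M + r))) := by
    refine (ENNReal.continuous_ofReal.tendsto _).comp ?_
    have h2 := (tendsto_const_div_atTop_nhds_zero_nat (p * M)).const_add (h * M + r)
    simpa using h2
  rw [← hlim.limsup_eq, constantCost_eq_limsup lam0 T c hh hp]
  refine limsup_le_limsup ?_
  filter_upwards [eventually_ge_atTop 1] with N hN
  have hN0 : (0 : ℝ) < N := by exact_mod_cast hN
  refine ENNReal.ofReal_le_ofReal ?_
  rw [div_le_iff₀ hN0]
  have h1 : ∑ n ∈ Finset.range N, meanLeftover lam0 T c (n + 1) ≤ N * M := by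
    refine (Finset.sum_le_sum fun n _ => hM (n + 1)).trans ?_
    simp
  have h2 := mul_le_mul_of_nonneg_left h1 hh
  have h3 := mul_le_mul_of_nonneg_left (hM N) hp
  have h4 : (h * M + r + p * M / N) * N = h * (N * M) + N * r + p * M := by
    field_simp
  rw [h4]
  linarith

/-- Cesàro means of an increasing sequence tend to its supremum; when that is finite, the boundary
term p e_N / N vanishes. As a supremum of continuous functions of c, the cost is lower
semicontinuous. -/
lemma constantCost_eq_iSup {h p : ℝ} (hh : 0 < h) (hp : 0 ≤ p) :
    constantCost lam0 T h p c =
      ⨆ n, ENNReal.ofReal (h * meanLeftover lam0 T c n + p * (T * (1 - (lam0 : ℝ)) - c)) := by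
  set r := p * (T * (1 - (lam0 : ℝ)) - c) with hr
  refine le_antisymm ?_ (iSup_le fun n => ofReal_le_constantCost lam0 T c hh.le hp n)
  set s := ⨆ n, ENNReal.ofReal (h * meanLeftover lam0 T c n + r) with hs
  rcases eq_or_ne s ⊤ with htop | htop
  · rw [htop]; exact le_top
  have hle : ∀ n, h * meanLeftover lam0 T c n + r ≤ s.toReal := fun n =>
    (ENNReal.ofReal_le_iff_le_toReal htop).mp (le_iSup (fun n =>
      ENNReal.ofReal (h * meanLeftover lam0 T c n + r)) n)
  -- This M solves h M + r = s.
  refine (constantCost_le_ofReal lam0 T c (M := (s.toReal - r) / h) hh.le hp fun n => ?_).trans ?_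
  · rw [le_div_iff₀ hh]; linarith [hle n]
  · rw [mul_div_cancel₀ _ hh.ne', ← hr, sub_add_cancel, ENNReal.ofReal_toReal htop]

/-! ### Lower and upper bounds for the mean leftover -/

lemma le_constantStart_sub_sum (H : Path) (n : ℕ) :
    n * c - ∑ i ∈ Finset.range n, (demand T H i : ℝ) ≤ constantStart T c H n - c := by
  induction n with
  | zero => simp [constantStart]
  | succ n ih =>
    rw [Finset.sum_range_succ, constantStart_succ]
    have := le_max_left (constantStart T c H n - demand T H n) 0
    push_cast; linarith

/-- The walk with steps `c - Dⁿ` bounds the leftover inventory from below. -/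
lemma sqrt_sub_le_meanLeftover (n : ℕ) :
    (1 - (lam0 : ℝ)) * (1 - (1 - (lam0 : ℝ))) / 4 * (√n * √T) -
      n * max (T * (1 - (lam0 : ℝ)) - c) 0 ≤ meanLeftover lam0 T c n := by
  have h0 : 0 ≤ 1 - (lam0 : ℝ) := by linarith [lam0.2.2]
  have h1 : 1 - (lam0 : ℝ) ≤ 1 := by linarith [lam0.2.1]
  set q := 1 - (lam0 : ℝ) with hq
  have key := integral_comp_arrivals lam0 (Finset.range n ×ˢ Finset.range T)
    (fun k => max (n * c - k) 0)
  rw [Finset.card_product, Finset.card_range, Finset.card_range] at key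
  have hle : binExp q (n * T) (fun k => max (n * c - k) 0) ≤ meanLeftover lam0 T c n := by
    rw [← key, meanLeftover_eq_integral]
    refine integral_mono (integrable_of_continuous lam0 ?_) (integrable_of_continuous lam0
      ((continuous_constantStart T c n).sub continuous_const)) fun H => ?_
    · exact continuous_apply_nat (F := fun _ k => max (n * c - k) 0) (fun _ => continuous_const)
        (continuous_arrivals _)
    · refine max_le ?_ (sub_nonneg.mpr (le_constantStart T c H n))
      rw [arrivals_product, Nat.cast_sum]
      exact le_constantStart_sub_sum T c H n
  refine le_trans ?_ hle
  have hneg := sqrt_le_binExp_neg_part h0 h1 (n * T)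
  -- Moving the centre from nTq to nc costs at most n max(Tq - c, 0).
  have hpt : ∀ k : ℕ, max (((n * T : ℕ) : ℝ) * q - k) 0 ≤
      max (n * c - k) 0 + n * max (T * q - c) 0 := fun k => by
    have hn : (0 : ℝ) ≤ n := n.cast_nonneg
    have a1 := le_max_left (n * c - (k : ℝ)) 0
    have a2 := le_max_right (n * c - (k : ℝ)) 0
    have a3 := mul_le_mul_of_nonneg_left (le_max_left (T * q - c) 0) hn
    have a4 := mul_nonneg hn (le_max_right (T * q - c) 0)
    refine max_le ?_ (by linarith)
    push_cast; linarith
  have := binExp_mono h0 h1 (n * T) hpt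
  rw [binExp_add, binExp_const] at this
  have hsq : √((n * T : ℕ) : ℝ) = √n * √T := by push_cast; exact Real.sqrt_mul n.cast_nonneg _
  rw [hsq] at hneg
  linarith

lemma binExp_sub_sq (q x : ℝ) (m : ℕ) :
    binExp q m (fun k => (x - (k : ℝ)) ^ 2) = (x - m * q) ^ 2 + m * (q * (1 - q)) := by
  have : ∀ k : ℕ, (x - (k : ℝ)) ^ 2 = ((k : ℝ) - m * q) ^ 2 +
      ((-2 * (x - m * q)) * ((k : ℝ) - m * q) + (x - m * q) ^ 2) := fun k => by ring
  rw [binExp_congr this, binExp_add, binExp_add, binExp_const_mul, binExp_centered_sq,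
    binExp_centered_one, binExp_const]
  ring

/-- Kingman's bound for the leftover inventory. -/
lemma meanLeftover_kingman (n : ℕ) :
    2 * (T * (1 - (lam0 : ℝ)) - c) * meanLeftover lam0 T c n ≤
      T * ((1 - (lam0 : ℝ)) * (1 - (1 - (lam0 : ℝ)))) + (T * (1 - (lam0 : ℝ)) - c) ^ 2 := by
  have h0 : 0 ≤ 1 - (lam0 : ℝ) := by linarith [lam0.2.2]
  have h1 : 1 - (lam0 : ℝ) ≤ 1 := by linarith [lam0.2.1]
  set q := 1 - (lam0 : ℝ) with hq
  set δ := T * q - c with hδ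
  have hI := continuous_constantStart T c n
  -- With W_n the leftover, E[W_n²] ≤ E[W_{n+1}²] ≤ E[(W_n + c - D)²] = E[W_n²] - 2δ E[W_n] + T
  -- q(1-q) + δ². Cancelling E[W_n²] gives the bound for every n, without a stationary law. The
  -- positive part makes the test function monotone on the whole line.
  have hgc : Continuous fun x : ℝ => (max (x - c) 0) ^ 2 := by fun_prop
  have hgm : Monotone fun x : ℝ => (max (x - c) 0) ^ 2 := fun x y hxy =>
    pow_le_pow_left₀ (le_max_right _ _) (max_le_max (by linarith) le_rfl) 2
  have h2 := integral_constantStart_mono lam0 T c hgc hgm n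
  rw [integral_constantStart_succ lam0 T c hgc n] at h2
  have h3 : ∫ H, binExp q T (fun k =>
      (max (max (constantStart T c H n - k) 0 + c - c) 0) ^ 2) ∂(pathLaw lam0) ≤
      ∫ H, ((max (constantStart T c H n - c) 0) ^ 2 +
        ((-(2 * δ)) * (constantStart T c H n - c) + (T * (q * (1 - q)) + δ ^ 2)))
          ∂(pathLaw lam0) := by
    refine integral_mono (integrable_of_continuous lam0 (continuous_binExp q T fun k => ?_))
      (integrable_of_continuous lam0 ?_) fun H => ?_
    · fun_prop
    · fun_prop
    · have e : (max (constantStart T c H n - c) 0) ^ 2 + ((-(2 * δ)) * (constantStart T c H n - c) +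
          (T * (q * (1 - q)) + δ ^ 2)) =
          binExp q T (fun k => (constantStart T c H n - (k : ℝ)) ^ 2) := by
        rw [binExp_sub_sq, max_eq_left (sub_nonneg.mpr (le_constantStart T c H n))]
        rw [hδ]; ring
      simp only [e]
      refine binExp_mono h0 h1 T fun k => ?_
      rw [add_sub_cancel_right, max_eq_left (le_max_right _ _), ← sq_abs (_ - (k : ℝ))]
      exact pow_le_pow_left₀ (le_max_right _ _) (max_le (le_abs_self _) (abs_nonneg _)) 2
  have h4 := h2.trans h3
  rw [integral_add, integral_add, integral_const_mul, ← meanLeftover_eq_integral, integral_const,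
    probReal_univ, one_smul] at h4
  · linarith
  all_goals exact integrable_of_continuous lam0 (by fun_prop)

end

/-- Without negative drift, fluctuations alone push the mean leftover above κ√(nT), which is
unbounded in n. -/
lemma constantCost_eq_top (lam0 : unitInterval) (hlam0 : 0 < lam0) (hlam1 : lam0 < 1) {T : ℕ}
    (hT : 1 ≤ T) {h p : ℝ} (hh : 0 < h) (hp : 0 ≤ p) {c : ℝ} (hc : T * (1 - (lam0 : ℝ)) ≤ c) :
    constantCost lam0 T h p c = ⊤ := by
  have hl0 : (0 : ℝ) < lam0 := hlam0
  have hl1 : (lam0 : ℝ) < 1 := hlam1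
  have hκ : 0 < (1 - (lam0 : ℝ)) * (1 - (1 - (lam0 : ℝ))) / 4 :=
    div_pos (mul_pos (by linarith) (by linarith)) (by norm_num)
  set κ := (1 - (lam0 : ℝ)) * (1 - (1 - (lam0 : ℝ))) / 4 with hκd
  have hsT : 0 < √(T : ℝ) := Real.sqrt_pos.mpr (by exact_mod_cast hT)
  have hlim : Tendsto (fun n : ℕ => ENNReal.ofReal (h * κ * √T * √n +
      p * (T * (1 - (lam0 : ℝ)) - c))) atTop (𝓝 ⊤) := by
    refine ENNReal.tendsto_ofReal_atTop.comp (tendsto_atTop_add_const_right _ _ ?_)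
    exact (Real.tendsto_sqrt_atTop.comp tendsto_natCast_atTop_atTop).const_mul_atTop
      (mul_pos (mul_pos hh hκ) hsT)
  refine top_le_iff.mp (le_of_tendsto hlim (Eventually.of_forall fun n => ?_))
  refine le_trans (ENNReal.ofReal_le_ofReal ?_) (ofReal_le_constantCost lam0 T c hh.le hp n)
  have := sqrt_sub_le_meanLeftover lam0 T c n
  rw [max_eq_right (by linarith), mul_zero, sub_zero, ← hκd] at this
  have := mul_le_mul_of_nonneg_left this hh.le
  linarith

lemma constantCost_zero_le (lam0 : unitInterval) (T : ℕ) {h p : ℝ} (hh : 0 ≤ h) (hp : 0 ≤ p) :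
    constantCost lam0 T h p 0 ≤ ENNReal.ofReal (p * (T * (1 - (lam0 : ℝ)))) := by
  have hz : ∀ n H, constantStart T 0 H n = 0 := fun n H => by
    induction n with
    | zero => rfl
    | succ n ih => rw [constantStart_succ, ih]; simp
  have := constantCost_le_ofReal lam0 T 0 (M := 0) hh hp fun n => by
    simp [meanLeftover, hz]
  simpa using this

lemma exists_isOptimal_constantCost (lam0 : unitInterval) (hlam0 : 0 < lam0) (hlam1 : lam0 < 1)
    {A : Set ℝ} (hA : A = Set.range (fun m : ℕ => (m : ℝ)) ∨ A = Set.Ici 0) {T : ℕ} (hT : 1 ≤ T)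
    {h p : ℝ} (hh : 0 < h) (hp : 0 ≤ p) :
    ∃ c, IsOptimal A (constantCost lam0 T h p) c := by
  refine exists_isOptimal hA (φ := constantCost lam0 T h p) (fun _ _ => rfl) ?_
    (R := T * (1 - (lam0 : ℝ))) ?_ fun c hc => ?_
  · have : constantCost lam0 T h p = fun c => ⨆ n, ENNReal.ofReal
        (h * meanLeftover lam0 T c n + p * (T * (1 - (lam0 : ℝ)) - c)) :=
      funext fun c => constantCost_eq_iSup lam0 T c hh hp
    rw [this]
    refine lowerSemicontinuous_iSup fun n => Continuous.lowerSemicontinuous ?_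
    have := continuous_meanLeftover lam0 T n
    exact ENNReal.continuous_ofReal.comp (by fun_prop)
  · exact mul_nonneg T.cast_nonneg (by linarith [lam0.2.2])
  · rw [constantCost_eq_top lam0 hlam0 hlam1 hT hh hp hc.le]; exact le_top

/-- Ordering nothing has finite cost, whereas c ≥ Tq costs ∞. -/
lemma optimal_lt_mean (lam0 : unitInterval) (hlam0 : 0 < lam0) (hlam1 : lam0 < 1)
    {A : Set ℝ} (hA : A = Set.range (fun m : ℕ => (m : ℝ)) ∨ A = Set.Ici 0) {T : ℕ} (hT : 1 ≤ T)
    {h p : ℝ} (hh : 0 < h) (hp : 0 ≤ p) {c : ℝ} (hc : IsOptimal A (constantCost lam0 T h p) c) :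
    c < T * (1 - (lam0 : ℝ)) := by
  by_contra hcon
  have htop := constantCost_eq_top lam0 hlam0 hlam1 hT hh hp (not_lt.mp hcon)
  have h0 := isMinOn_iff.mp hc.2 0 (by simpa using natCast_admissible hA 0)
  rw [htop, top_le_iff] at h0
  have := constantCost_zero_le lam0 T hh.le hp
  rw [h0, top_le_iff] at this
  exact ENNReal.ofReal_ne_top this

/-! ### The series of partial-sum overages -/

lemma a2Term_succ (lam0 : unitInterval) (T : ℕ) {c : ℝ} (hc : 0 ≤ c) (n : ℕ) :
    a2Term lam0 T c (n + 1) = 1 / ((n + 1 : ℕ) : ℝ) *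
      binExp (1 - (lam0 : ℝ)) ((n + 1) * T) (fun k => max (((n + 1 : ℕ) : ℝ) * c - k) 0) := by
  have hn : ((n + 1 : ℕ) : ℝ) ≠ 0 := by positivity
  rw [← sum_overage lam0 _ (by positivity), Finset.mul_sum, a2Term]
  refine Finset.sum_congr rfl fun k _ => ?_
  field_simp

lemma a2Term_succ_nonneg (lam0 : unitInterval) (T : ℕ) {c : ℝ} (hc : 0 ≤ c) (n : ℕ) :
    0 ≤ a2Term lam0 T c (n + 1) := by
  rw [a2Term_succ lam0 T hc]
  refine mul_nonneg (by positivity) ?_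
  exact (binExp_const (1 - (lam0 : ℝ)) ((n + 1) * T) 0).symm.le.trans
    (binExp_mono (by linarith [lam0.2.2]) (by linarith [lam0.2.1]) _ fun k => le_max_right _ _)

/-- A positive overage y = Nc - k means that k lies y + Nδ below its mean, so y(Nδ)³ ≤ (k - NTq)⁴.
The fourth moment is at most (NT)², which leaves a summable 1/N²; the same argument with the second
moment would leave 1/N. -/
lemma a2Term_succ_le (lam0 : unitInterval) (T : ℕ) {c : ℝ} (hc : 0 ≤ c)
    (hcT : c < T * (1 - (lam0 : ℝ))) (n : ℕ) :
    a2Term lam0 T c (n + 1) ≤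
      (T : ℝ) ^ 2 / (T * (1 - (lam0 : ℝ)) - c) ^ 3 * (1 / ((n + 1 : ℕ) : ℝ) ^ 2) := by
  have h0 : 0 ≤ 1 - (lam0 : ℝ) := by linarith [lam0.2.2]
  have h1 : 1 - (lam0 : ℝ) ≤ 1 := by linarith [lam0.2.1]
  rw [a2Term_succ lam0 T hc]
  set q := 1 - (lam0 : ℝ) with hq
  obtain ⟨δ, hδ⟩ : ∃ δ, δ = T * q - c := ⟨_, rfl⟩
  have hδ0 : 0 < δ := by linarith
  set N := n + 1 with hN
  have hN0 : (0 : ℝ) < N := by rw [hN]; positivity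
  rw [← hδ]
  have hpt : ∀ k : ℕ, max ((N : ℝ) * c - k) 0 ≤
      1 / (N * δ) ^ 3 * ((k : ℝ) - ((N * T : ℕ) : ℝ) * q) ^ 4 := by
    intro k
    refine max_le ?_ (by positivity)
    rcases le_or_gt ((N : ℝ) * c - k) 0 with hk | hk
    · exact hk.trans (by positivity)
    obtain ⟨a, ha⟩ : ∃ a, a = N * δ := ⟨_, rfl⟩
    have ha0 : 0 < a := by rw [ha]; positivity
    have e : (k : ℝ) - ((N * T : ℕ) : ℝ) * q = -((N * c - k) + a) := by
      rw [ha, hδ]; push_cast; ring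
    rw [e, ← ha, one_div_mul_eq_div, le_div_iff₀ (by positivity)]
    generalize (N : ℝ) * c - k = y at hk
    calc y * a ^ 3 ≤ (y + a) * (y + a) ^ 3 :=
          mul_le_mul (by linarith) (pow_le_pow_left₀ ha0.le (by linarith) 3) (by positivity)
            (by positivity)
      _ = (-(y + a)) ^ 4 := by ring
  have hb := binExp_mono h0 h1 (N * T) hpt
  rw [binExp_const_mul] at hb
  have h4 := binExp_centered_four_le h0 h1 (N * T)
  calc 1 / (N : ℝ) * binExp q (N * T) (fun k => max ((N : ℝ) * c - k) 0)
      ≤ 1 / (N : ℝ) * (1 / (N * δ) ^ 3 * ((N * T : ℕ) : ℝ) ^ 2) :=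
        mul_le_mul_of_nonneg_left (hb.trans (mul_le_mul_of_nonneg_left h4 (by positivity)))
          (by positivity)
    _ = (T : ℝ) ^ 2 / δ ^ 3 * (1 / (N : ℝ) ^ 2) := by
        push_cast; field_simp

lemma summable_one_div_succ_sq : Summable fun n : ℕ => 1 / ((n + 1 : ℕ) : ℝ) ^ 2 :=
  (summable_nat_add_iff (f := fun n : ℕ => 1 / (n : ℝ) ^ 2) 1).mpr
    (Real.summable_one_div_nat_pow.mpr (by norm_num))

lemma summable_a2Term (lam0 : unitInterval) (T : ℕ) {c : ℝ} (hc : 0 ≤ c)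
    (hcT : c < T * (1 - (lam0 : ℝ))) : Summable fun n : ℕ => a2Term lam0 T c (n + 1) :=
  Summable.of_nonneg_of_le (a2Term_succ_nonneg lam0 T hc) (a2Term_succ_le lam0 T hc hcT)
    (summable_one_div_succ_sq.mul_left _)

lemma tsum_a2Term_le (lam0 : unitInterval) (T : ℕ) {c : ℝ} (hc : 0 ≤ c)
    (hcT : c < T * (1 - (lam0 : ℝ))) : ∑' n : ℕ, a2Term lam0 T c (n + 1) ≤
      (T : ℝ) ^ 2 / (T * (1 - (lam0 : ℝ)) - c) ^ 3 * ∑' n : ℕ, 1 / ((n + 1 : ℕ) : ℝ) ^ 2 := by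
  rw [← tsum_mul_left]
  exact (summable_a2Term lam0 T hc hcT).tsum_le_tsum (a2Term_succ_le lam0 T hc hcT)
    (summable_one_div_succ_sq.mul_left _)

/-! ### The order of the optimal gap and of the optimal cost -/

/-- A gap δ of order √T balances the holding cost, of order T/δ, against the penalty pδ. The floor
keeps the quantity an integer and, as √T ≥ 1, leaves √T ≤ δ ≤ 2√T. -/
lemma constantCost_floor_le (lam0 : unitInterval) {T : ℕ} (hT : 1 ≤ T)
    (hTq : √(T : ℝ) ≤ T * (1 - (lam0 : ℝ))) {h p : ℝ} (hh : 0 ≤ h) (hp : 0 ≤ p) :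
    constantCost lam0 T h p ⌊T * (1 - (lam0 : ℝ)) - √(T : ℝ)⌋₊ ≤
      ENNReal.ofReal (2 * (h + p) * √T) := by
  have hs : 1 ≤ √(T : ℝ) := Real.one_le_sqrt.mpr (by exact_mod_cast hT)
  have hss : √(T : ℝ) ^ 2 = T := Real.sq_sqrt T.cast_nonneg
  have f1 : (⌊T * (1 - (lam0 : ℝ)) - √(T : ℝ)⌋₊ : ℝ) ≤ T * (1 - (lam0 : ℝ)) - √(T : ℝ) :=
    Nat.floor_le (by linarith)
  have f2 := Nat.lt_floor_add_one (T * (1 - (lam0 : ℝ)) - √(T : ℝ))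
  set c : ℝ := (⌊T * (1 - (lam0 : ℝ)) - √(T : ℝ)⌋₊ : ℝ) with hc
  have hbound : ∀ n, meanLeftover lam0 T c n ≤ 2 * √T := fun n => by
    have hk := meanLeftover_kingman lam0 T c n
    have hv : (1 - (lam0 : ℝ)) * (1 - (1 - (lam0 : ℝ))) ≤ 1 := by
      nlinarith [sq_nonneg ((lam0 : ℝ) - 1 / 2)]
    have he := meanLeftover_nonneg lam0 T c n
    have hTv := mul_le_mul_of_nonneg_left hv (Nat.cast_nonneg (α := ℝ) T)
    generalize meanLeftover lam0 T c n = e at hk he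
    obtain ⟨δ, hδ⟩ : ∃ δ, δ = T * (1 - (lam0 : ℝ)) - c := ⟨_, rfl⟩
    rw [← hδ] at hk
    have hδ1 : √(T : ℝ) ≤ δ := by linarith
    have hδ2 : δ ≤ 2 * √(T : ℝ) := by linarith
    have hδ0 : 0 < δ := by linarith
    have h1 : 2 * δ * e ≤ 2 * δ * (2 * √T) := by
      refine hk.trans ?_
      have : (T : ℝ) ≤ δ * √T := by nlinarith
      nlinarith
    exact le_of_mul_le_mul_left h1 (by linarith)
  refine (constantCost_le_ofReal lam0 T c hh hp hbound).trans (ENNReal.ofReal_le_ofReal ?_)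
  have : p * (T * (1 - (lam0 : ℝ)) - c) ≤ p * (2 * √T) :=
    mul_le_mul_of_nonneg_left (by linarith) hp
  linarith

lemma a2_isTheta (lam0 : unitInterval) (hlam0 : 0 < lam0) (hlam1 : lam0 < 1)
    {A : Set ℝ} (hA : A = Set.range (fun m : ℕ => (m : ℝ)) ∨ A = Set.Ici 0)
    {h p : ℝ} (hh : 0 < h) (hp : 0 < p) {c : ℕ → ℝ}
    (hc : ∀ T : ℕ, 1 ≤ T → IsOptimal A (constantCost lam0 T h p) (c T)) :
    (fun T : ℕ => a2 lam0 T h p (c T)) =Θ[atTop] (fun T : ℕ => √(T : ℝ)) := by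
  have hl0 : (0 : ℝ) < lam0 := hlam0
  have hl1 : (lam0 : ℝ) < 1 := hlam1
  have hκ : 0 < (1 - (lam0 : ℝ)) * (1 - (1 - (lam0 : ℝ))) / 4 :=
    div_pos (mul_pos (by linarith) (by linarith)) (by norm_num)
  set κ := (1 - (lam0 : ℝ)) * (1 - (1 - (lam0 : ℝ))) / 4 with hκd
  set G := 2 * (h + p) with hG
  have hG0 : 0 < G := by positivity
  -- The horizon n does not depend on T. It is long enough for the fluctuation cost hκ√(nT) to be at
  -- least 2G√T, twice the bound on the optimal cost.
  obtain ⟨n, hn1, hn⟩ : ∃ n : ℕ, 1 ≤ n ∧ 2 * G / (h * κ) ≤ √(n : ℝ) := by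
    have := (Real.tendsto_sqrt_atTop.comp tendsto_natCast_atTop_atTop).eventually_ge_atTop
      (2 * G / (h * κ))
    exact ((eventually_ge_atTop 1).and this).exists
  have hn0 : (0 : ℝ) < n := by exact_mod_cast hn1
  have hnG : 2 * G ≤ h * κ * √(n : ℝ) := by
    rw [div_le_iff₀ (mul_pos hh hκ)] at hn; linarith
  obtain ⟨η, hη⟩ : ∃ η, η = G / (h * n) := ⟨_, rfl⟩
  have hη0 : 0 < η := by rw [hη]; positivity
  set Z := ∑' n : ℕ, 1 / ((n + 1 : ℕ) : ℝ) ^ 2 with hZ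
  have hZ0 : 0 ≤ Z := tsum_nonneg fun n => by positivity
  have hTq : ∀ᶠ T : ℕ in atTop, √(T : ℝ) ≤ T * (1 - (lam0 : ℝ)) := by
    filter_upwards [(Real.tendsto_sqrt_atTop.comp tendsto_natCast_atTop_atTop).eventually_ge_atTop
      (1 / (1 - (lam0 : ℝ)))] with T hT
    have hq : 0 < 1 - (lam0 : ℝ) := by linarith
    simp only [Function.comp_apply] at hT
    rw [div_le_iff₀ hq] at hT
    nlinarith [Real.sq_sqrt (Nat.cast_nonneg (α := ℝ) T), Real.sqrt_nonneg (T : ℝ)]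
  have main : ∀ᶠ T : ℕ in atTop, p * η * √(T : ℝ) ≤ a2 lam0 T h p (c T) ∧
      a2 lam0 T h p (c T) ≤ (h * (Z / η ^ 3) + G) * √(T : ℝ) := by
    filter_upwards [eventually_ge_atTop 1, hTq] with T hT hTq
    have hs : 0 < √(T : ℝ) := Real.sqrt_pos.mpr (by exact_mod_cast hT)
    have hss : √(T : ℝ) ^ 2 = T := Real.sq_sqrt T.cast_nonneg
    have hc0 := nonneg_of_admissible hA (hc T hT).1
    have hcT := optimal_lt_mean lam0 hlam0 hlam1 hA hT hh hp.le (hc T hT)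
    have hopt := (isMinOn_iff.mp (hc T hT).2 _ (natCast_admissible hA _)).trans
      (constantCost_floor_le lam0 hT hTq hh.le hp.le)
    have hlow : ∀ m, h * meanLeftover lam0 T (c T) m + p * (T * (1 - (lam0 : ℝ)) - c T) ≤
        G * √T := fun m => by
      have := (ofReal_le_constantCost lam0 T (c T) hh.le hp.le m).trans hopt
      rwa [ENNReal.ofReal_le_ofReal_iff (by positivity)] at this
    obtain ⟨δ, hδ⟩ : ∃ δ, δ = T * (1 - (lam0 : ℝ)) - c T := ⟨_, rfl⟩
    have hδ0 : 0 < δ := by linarith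
    have hδu : p * δ ≤ G * √T := by
      have := hlow 0
      rw [meanLeftover_zero] at this
      rw [hδ]; linarith
    -- The drift nδ must absorb the excess: 2G√T - hnδ + pδ ≤ G√T, hence hnδ ≥ G√T, which is where η
    -- = G/(hn) comes from.
    have hδl : η * √T ≤ δ := by
      have h1 := hlow n
      have h2 := mul_le_mul_of_nonneg_left (sqrt_sub_le_meanLeftover lam0 T (c T) n) hh.le
      rw [← hδ, max_eq_left hδ0.le, ← hκd] at h2
      rw [← hδ] at h1
      have h3 := mul_le_mul_of_nonneg_right hnG hs.le
      have h4 : 0 < p * δ := mul_pos hp hδ0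
      have h5 : G * √T ≤ δ * (h * n) := by nlinarith
      rw [hη, div_mul_eq_mul_div, div_le_iff₀ (by positivity)]
      exact h5
    have ha2 : a2 lam0 T h p (c T) =
        h * ∑' n : ℕ, a2Term lam0 T (c T) (n + 1) + p * δ := by rw [a2, hδ]; ring
    have hsum0 : 0 ≤ ∑' n : ℕ, a2Term lam0 T (c T) (n + 1) :=
      tsum_nonneg (a2Term_succ_nonneg lam0 T hc0)
    have hsum := tsum_a2Term_le lam0 T hc0 hcT
    rw [← hδ, ← hZ] at hsum
    rw [ha2]
    constructor
    · have := mul_le_mul_of_nonneg_left hδl hp.le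
      have := mul_nonneg hh.le hsum0
      linarith
    · have h1 : (T : ℝ) ^ 2 / δ ^ 3 ≤ √T / η ^ 3 := by
        have h2 : (η * √(T : ℝ)) ^ 3 ≤ δ ^ 3 := pow_le_pow_left₀ (by positivity) hδl 3
        rw [div_le_div_iff₀ (by positivity) (by positivity)]
        calc (T : ℝ) ^ 2 * η ^ 3 = √T * (η * √(T : ℝ)) ^ 3 := by
              rw [← hss, Real.sqrt_sq (Real.sqrt_nonneg _)]; ring
          _ ≤ √T * δ ^ 3 := mul_le_mul_of_nonneg_left h2 hs.le
      have h3 := mul_le_mul_of_nonneg_left (hsum.trans (mul_le_mul_of_nonneg_right h1 hZ0)) hh.le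
      have h4 : h * (√T / η ^ 3 * Z) = h * (Z / η ^ 3) * √T := by ring
      rw [h4] at h3
      linarith
  constructor
  · refine IsBigO.of_bound (h * (Z / η ^ 3) + G) ?_
    filter_upwards [main] with T hT
    rw [Real.norm_of_nonneg (le_trans (by positivity) hT.1),
      Real.norm_of_nonneg (Real.sqrt_nonneg _)]
    exact hT.2
  · refine IsBigO.of_bound (p * η)⁻¹ ?_
    filter_upwards [main] with T hT
    rw [Real.norm_of_nonneg (le_trans (by positivity) hT.1),
      Real.norm_of_nonneg (Real.sqrt_nonneg _), inv_mul_eq_div, le_div_iff₀ (by positivity)]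
    linarith [hT.1]

end Replenishment

theorem mainTheorem4 (L : ℕ) (h p : ℝ) (lam0 : unitInterval)
    (hh : 0 < h) (hp : 0 < p) (hlam0 : 0 < lam0) (hlam1 : lam0 < 1)
    -- order quantities and base-stock levels are nonnegative integers, or nonnegative reals
    (A : Set ℝ) (hA : A = Set.range (fun m : ℕ => (m : ℝ)) ∨ A = Set.Ici 0) :
    -- optimal base-stock levels and order quantities exist
    (∀ T : ℕ, 1 ≤ T →
      (∃ S, Replenishment.IsOptimal A (Replenishment.backorderCost lam0 L T h (p + L * h)) S) ∧
      (∃ S, Replenishment.IsOptimal A (Replenishment.backorderCost lam0 L T h (p / (L + 1))) S) ∧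
      (∃ c, Replenishment.IsOptimal A (Replenishment.constantCost lam0 T h p) c)) ∧
    -- and whichever of them are used, the three functions are of order `√T`
    (∀ Sbar Sunder cstar : ℕ → ℝ,
      (∀ T : ℕ, 1 ≤ T → Replenishment.IsOptimal A
        (Replenishment.backorderCost lam0 L T h (p + L * h)) (Sbar T)) →
      (∀ T : ℕ, 1 ≤ T → Replenishment.IsOptimal A
        (Replenishment.backorderCost lam0 L T h (p / (L + 1))) (Sunder T)) →
      (∀ T : ℕ, 1 ≤ T → Replenishment.IsOptimal A
        (Replenishment.constantCost lam0 T h p) (cstar T)) →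
      (fun T : ℕ => Replenishment.a1Upper lam0 L T h p (Sbar T))
          =Θ[atTop] (fun T : ℕ => Real.sqrt T) ∧
      (fun T : ℕ => Replenishment.a1Lower lam0 L T h p (Sunder T))
          =Θ[atTop] (fun T : ℕ => Real.sqrt T) ∧
      (∀ T : ℕ, 1 ≤ T →
        Summable fun n : ℕ => Replenishment.a2Term lam0 T (cstar T) (n + 1)) ∧
      (fun T : ℕ => Replenishment.a2 lam0 T h p (cstar T))
          =Θ[atTop] (fun T : ℕ => Real.sqrt T)) := by
  have hpL : 0 < p + L * h := by positivity
  have hpL' : 0 < p / ((L : ℝ) + 1) := by positivity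
  refine ⟨fun T hT => ⟨?_, ?_, ?_⟩, fun Sbar Sunder cstar hSbar hSunder hcstar =>
    ⟨?_, ?_, fun T hT => ?_, ?_⟩⟩
  · exact Replenishment.exists_isOptimal_backorderCost lam0 L T hA hh hpL.le
  · exact Replenishment.exists_isOptimal_backorderCost lam0 L T hA hh hpL'.le
  · exact Replenishment.exists_isOptimal_constantCost lam0 hlam0 hlam1 hA hT hh hp.le
  · exact Replenishment.pipelineCost_isTheta lam0 L hlam0 hlam1 hA hh hpL hSbar
  · exact Replenishment.pipelineCost_isTheta lam0 L hlam0 hlam1 hA hh hpL' hSunder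
  · exact Replenishment.summable_a2Term lam0 T
      (Replenishment.nonneg_of_admissible hA (hcstar T hT).1)
      (Replenishment.optimal_lt_mean lam0 hlam0 hlam1 hA hT hh hp.le (hcstar T hT))
  · exact Replenishment.a2_isTheta lam0 hlam0 hlam1 hA hh hp hcstar
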